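/- Let $G$ and $H$ be locally compact groups and let $p,q\in(1,\infty)$. For $p'$ with $\frac1p+\frac1{p'}=1$, let $A_p(G)$ be the Figà-Talamanca–Herz algebra, that is, the space of all functions $a\colon G\to\mathbb C$ of the form $a=\sum_{n=1}^\infty \xi_n*\check\eta_n$ with $\xi_n\in L^p(G)$, $\eta_n\in L^{p'}(G)$ and $\sum_{n}\|\xi_n\|_p\|\eta_n\|_{p'}<\infty$ (with respect to left Haar measure, where $\check\eta(x)=\eta(x^{-1})$), normed by the infimum of $\sum_n\|\xi_n\|_p\|\eta_n\|_{p'}$ over all such representations of $a$; define $A_q(H)$ in the same way. Let $A_p(G)\hat\otimes A_q(H)$ be the projective tensor product over $\mathbb C$. Every $u\in A_p(G)\hat\otimes A_q(H)$ is regarded as a function on $G\times H$ through its Gelfand transform $u(x,y)=(\mathrm{ev}_x\otimes\mathrm{ev}_y)(u)$, so that $(a\otimes b)(x,y)=a(x)b(y)$. Let $(f_\alpha)_{\alpha\in\mathbb A}$ be a norm-bounded net in $A_p(G)\hat\otimes A_q(H)$ that converges pointwise on $G\times H$ to a function $f\colon G\times H\to\mathbb C$. Then there are a uniformly convex complex Banach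 space $E$ and an isometric representation $\pi$ of $G_d\times H_d$ on $E$ (a group homomorphism from $G\times H$, with the discrete topology, into the invertible linear isometries of $E$) such that, for every $C\ge 0$ with $\sup_\alpha\|f_\alpha\|\le C$, there are $\eta\in E$ and $\xi\in E^*$ with $\|\eta\|\,\|\xi\|\le C$ and $$f(x,y)=\langle\pi(x,y)\eta,\xi\rangle\qquad(x\in G,\ y\in H).$$ -/

import Mathlib

open MeasureTheory Filter Topology
open scoped ENNReal TensorProduct

universe u v w

/-! ### Infima of costs -/

/-- If every vector `u` has a set `S u` of admissible costs, compatible with the vector space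
operations, then `u ↦ inf (S u)` is a seminorm. -/
theorem seminormedSpaceCore_of_costs {E : Type*} [AddCommGroup E] [Module ℂ E] [Norm E]
    (S : E → Set ℝ) (hnorm : ∀ u, ‖u‖ = sInf (S u))
    (hnonneg : ∀ u, ∀ r ∈ S u, 0 ≤ r) (hne : ∀ u, (S u).Nonempty)
    (hadd : ∀ u v, ∀ r ∈ S u, ∀ s ∈ S v, r + s ∈ S (u + v))
    (hsmul : ∀ (c : ℂ) (u : E), ∀ r ∈ S u, ‖c‖ * r ∈ S (c • u)) :
    SeminormedSpace.Core ℂ E := by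
  have hbdd : ∀ u, BddBelow (S u) := fun u => ⟨0, fun r hr => hnonneg u r hr⟩
  have hle : ∀ (c : ℂ) (u : E), c ≠ 0 → ‖c • u‖ ≤ ‖c‖ * ‖u‖ := by
    intro c u hc
    have hc' : 0 < ‖c‖ := norm_pos_iff.2 hc
    rw [hnorm, hnorm, ← div_le_iff₀' hc']
    refine le_csInf (hne u) fun r hr => ?_
    rw [div_le_iff₀' hc']
    exact csInf_le (hbdd _) (hsmul c u r hr)
  have h0 : ‖(0 : E)‖ = 0 := by
    obtain ⟨r, hr⟩ := hne 0
    have h := hsmul 0 0 r hr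
    rw [norm_zero, zero_mul, zero_smul] at h
    rw [hnorm]
    exact le_antisymm (csInf_le (hbdd _) h) (Real.sInf_nonneg (hnonneg 0))
  refine ⟨fun u => ?_, fun c u => ?_, fun u v => ?_⟩
  · rw [hnorm]
    exact Real.sInf_nonneg (hnonneg u)
  · by_cases hc : c = 0
    · subst hc
      rw [zero_smul, h0, norm_zero, zero_mul]
    · refine le_antisymm (hle c u hc) ?_
      have h := hle c⁻¹ (c • u) (inv_ne_zero hc)
      rw [smul_smul, inv_mul_cancel₀ hc, one_smul, norm_inv] at h
      have hc' : 0 < ‖c‖ := norm_pos_iff.2 hc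
      calc ‖c‖ * ‖u‖ ≤ ‖c‖ * (‖c‖⁻¹ * ‖c • u‖) := by gcongr
        _ = ‖c • u‖ := by field_simp
  · refine le_of_forall_pos_lt_add fun ε hε => ?_
    obtain ⟨r, hr, hr'⟩ := exists_lt_of_csInf_lt (hne u)
      (show sInf (S u) < ‖u‖ + ε / 2 by rw [← hnorm]; linarith)
    obtain ⟨s, hs, hs'⟩ := exists_lt_of_csInf_lt (hne v)
      (show sInf (S v) < ‖v‖ + ε / 2 by rw [← hnorm]; linarith)
    rw [hnorm (u + v)]
    have := csInf_le (hbdd _) (hadd u v r hr s hs)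
    linarith

/-! ### The Figà-Talamanca–Herz algebra -/

section FigaTalamancaHerz

instance fact_one_lt_conjExponent (p : ℝ) [hp : Fact (1 < p)] : Fact (1 < p.conjExponent) :=
  ⟨(Real.HolderConjugate.conjExponent hp.out).symm.lt⟩

instance fact_one_le_ofReal (p : ℝ) [hp : Fact (1 < p)] : Fact (1 ≤ ENNReal.ofReal p) :=
  ⟨ENNReal.one_le_ofReal.2 hp.out.le⟩

/-- `L^p(G)`: the complex `L^p`-space with respect to (left) Haar measure. -/
abbrev LpHaar (p : ℝ) (G : Type*) [Group G] [TopologicalSpace G] [IsTopologicalGroup G]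
    [LocallyCompactSpace G] [MeasurableSpace G] [BorelSpace G] : Type _ :=
  Lp ℂ (ENNReal.ofReal p) (Measure.haar : Measure G)

/-- `f̌(x) = f(x⁻¹)`. -/
def invCheck {G : Type*} [Group G] (f : G → ℂ) : G → ℂ := fun x => f x⁻¹

variable {G : Type*} [Group G] [TopologicalSpace G] [IsTopologicalGroup G]
  [LocallyCompactSpace G] [MeasurableSpace G] [BorelSpace G]

/-- Convolution `(f * g)(x) = ∫ f(y) g(y⁻¹ x) dy` with respect to Haar measure. -/
noncomputable def haarConv (f g : G → ℂ) : G → ℂ :=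
  fun x => ∫ y, f y * g (y⁻¹ * x) ∂(Measure.haar : Measure G)

/-- `f = ∑ ξₙ * η̌ₙ` with `ξₙ ∈ L^p(G)`, `ηₙ ∈ L^{p'}(G)` and `∑ ‖ξₙ‖ ‖ηₙ‖ < ∞`. -/
def IsFTHExpansion (p : ℝ) (f : G → ℂ) (ξ : ℕ → LpHaar p G)
    (η : ℕ → LpHaar p.conjExponent G) : Prop :=
  Summable (fun n => ‖ξ n‖ * ‖η n‖) ∧
    ∀ x, HasSum (fun n => haarConv (ξ n) (invCheck (η n)) x) (f x)

/-- The set of all sums `∑ ‖ξₙ‖ ‖ηₙ‖` over the expansions `f = ∑ ξₙ * η̌ₙ`. -/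
def fthCosts (p : ℝ) (f : G → ℂ) : Set ℝ :=
  {r | ∃ (ξ : ℕ → LpHaar p G) (η : ℕ → LpHaar p.conjExponent G),
    IsFTHExpansion p f ξ η ∧ r = ∑' n, ‖ξ n‖ * ‖η n‖}

theorem haarConv_smul (p : ℝ) [Fact (1 < p)] (c : ℂ) (ξ : LpHaar p G) (g : G → ℂ) (x : G) :
    haarConv (c • ξ : LpHaar p G) g x = c * haarConv ξ g x := by
  unfold haarConv
  rw [← integral_const_mul]
  refine integral_congr_ae ?_
  filter_upwards [Lp.coeFn_smul c ξ] with y hy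
  rw [hy, Pi.smul_apply, smul_eq_mul, mul_assoc]

theorem norm_haarConv_le (p : ℝ) [hp : Fact (1 < p)] (ξ : LpHaar p G)
    (η : LpHaar p.conjExponent G) (x : G) :
    ‖haarConv ξ (invCheck η) x‖ ≤ ‖ξ‖ * ‖η‖ := by
  have hmp : MeasurePreserving (fun y : G => x⁻¹ * y) Measure.haar Measure.haar :=
    measurePreserving_mul_left Measure.haar x⁻¹
  have hη : MemLp ((η : G → ℂ) ∘ fun y : G => x⁻¹ * y) (ENNReal.ofReal p.conjExponent)
      (Measure.haar : Measure G) := (Lp.memLp η).comp_measurePreserving hmp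
  have hη' : eLpNorm ((η : G → ℂ) ∘ fun y : G => x⁻¹ * y) (ENNReal.ofReal p.conjExponent)
      (Measure.haar : Measure G) = eLpNorm η (ENNReal.ofReal p.conjExponent) Measure.haar :=
    eLpNorm_comp_measurePreserving (Lp.memLp η).1 hmp
  have : ENNReal.HolderConjugate (ENNReal.ofReal p) (ENNReal.ofReal p.conjExponent) :=
    (Real.HolderConjugate.conjExponent hp.out).ennrealOfReal
  have hH := eLpNorm_smul_le_mul_eLpNorm (r := 1) (p := ENNReal.ofReal p)
    (q := ENNReal.ofReal p.conjExponent) hη.1 (Lp.memLp ξ).1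
  have heq : haarConv ξ (invCheck η) x =
      ∫ y, ((ξ : G → ℂ) • ((η : G → ℂ) ∘ fun y : G => x⁻¹ * y)) y ∂Measure.haar := by
    simp [haarConv, invCheck, mul_inv_rev]
  have h1 := enorm_integral_le_lintegral_enorm (μ := (Measure.haar : Measure G))
    ((ξ : G → ℂ) • ((η : G → ℂ) ∘ fun y : G => x⁻¹ * y))
  rw [← heq, ← eLpNorm_one_eq_lintegral_enorm] at h1
  rw [hη'] at hH
  have h2 := ENNReal.toReal_mono
    (ENNReal.mul_ne_top (Lp.memLp ξ).2.ne (Lp.memLp η).2.ne) (h1.trans hH)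
  rw [ENNReal.toReal_mul, toReal_enorm] at h2
  rwa [Lp.norm_def, Lp.norm_def]

theorem IsFTHExpansion.norm_le {p : ℝ} [Fact (1 < p)] {f : G → ℂ} {ξ : ℕ → LpHaar p G}
    {η : ℕ → LpHaar p.conjExponent G} (h : IsFTHExpansion p f ξ η) (x : G) :
    ‖f x‖ ≤ ∑' n, ‖ξ n‖ * ‖η n‖ := by
  rw [← (h.2 x).tsum_eq]
  exact tsum_of_norm_bounded h.1.hasSum fun n => norm_haarConv_le p _ _ _

theorem fthCosts_nonneg (p : ℝ) (f : G → ℂ) (r : ℝ) (hr : r ∈ fthCosts p f) : 0 ≤ r := by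
  obtain ⟨ξ, η, -, rfl⟩ := hr
  exact tsum_nonneg fun n => mul_nonneg ENNReal.toReal_nonneg ENNReal.toReal_nonneg

theorem fthCosts_zero (p : ℝ) [Fact (1 < p)] : (0 : ℝ) ∈ fthCosts p (0 : G → ℂ) := by
  refine ⟨fun _ => 0, fun _ => 0, ⟨by simp [summable_zero], fun x => ?_⟩, by simp⟩
  have h : haarConv ((0 : LpHaar p G) : G → ℂ)
      (invCheck ((0 : LpHaar p.conjExponent G) : G → ℂ)) x = 0 := by
    simpa using norm_haarConv_le p (0 : LpHaar p G) 0 x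
  simp only [h, Pi.zero_apply]
  exact hasSum_zero

theorem fthCosts_add (p : ℝ) (f g : G → ℂ) (r : ℝ) (hr : r ∈ fthCosts p f)
    (s : ℝ) (hs : s ∈ fthCosts p g) : r + s ∈ fthCosts p (f + g) := by
  obtain ⟨ξ, η, ⟨h1, h2⟩, rfl⟩ := hr
  obtain ⟨ξ', η', ⟨h1', h2'⟩, rfl⟩ := hs
  have key : ∀ {α : Type} [AddCommMonoid α] [TopologicalSpace α] [ContinuousAdd α]
      (Φ : LpHaar p G → LpHaar p.conjExponent G → α) (a b : α),
      HasSum (fun n => Φ (ξ n) (η n)) a → HasSum (fun n => Φ (ξ' n) (η' n)) b →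
      HasSum (fun n => Φ (if Even n then ξ (n / 2) else ξ' (n / 2))
        (if Even n then η (n / 2) else η' (n / 2))) (a + b) := by
    intro α _ _ _ Φ a b ha hb
    refine HasSum.even_add_odd ?_ ?_
    · simpa using ha
    · have : ∀ k : ℕ, (2 * k + 1) / 2 = k := fun k => by omega
      simpa [this] using hb
  have hs := key (fun a b => ‖a‖ * ‖b‖) _ _ h1.hasSum h1'.hasSum
  exact ⟨fun n => if Even n then ξ (n / 2) else ξ' (n / 2),
    fun n => if Even n then η (n / 2) else η' (n / 2),
    ⟨hs.summable, fun x => key (fun a b => haarConv a (invCheck b) x) _ _ (h2 x) (h2' x)⟩,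
    hs.tsum_eq.symm⟩

theorem fthCosts_smul (p : ℝ) [Fact (1 < p)] (c : ℂ) (f : G → ℂ) (r : ℝ)
    (hr : r ∈ fthCosts p f) : ‖c‖ * r ∈ fthCosts p (c • f) := by
  obtain ⟨ξ, η, ⟨h1, h2⟩, rfl⟩ := hr
  refine ⟨fun n => c • ξ n, η, ⟨?_, fun x => ?_⟩, ?_⟩
  · simpa only [norm_smul, mul_assoc] using h1.mul_left ‖c‖
  · simp only [haarConv_smul]
    exact (h2 x).mul_left c
  · simp only [norm_smul, mul_assoc, tsum_mul_left]

variable (p : ℝ) [Fact (1 < p)] (G)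

/-- The functions on `G` that have an expansion `∑ ξₙ * η̌ₙ`, as a subspace of `G → ℂ`. -/
def fthSubmodule : Submodule ℂ (G → ℂ) where
  carrier := {f | (fthCosts p f).Nonempty}
  zero_mem' := ⟨0, fthCosts_zero p⟩
  add_mem' := fun ⟨r, hr⟩ ⟨s, hs⟩ => ⟨r + s, fthCosts_add p _ _ r hr s hs⟩
  smul_mem' := fun c _ ⟨r, hr⟩ => ⟨‖c‖ * r, fthCosts_smul p c _ r hr⟩

/-- The Figà-Talamanca–Herz algebra `A_p(G)`, with its own norm (not a subspace norm). -/
def FTHAlgebra : Type _ := ↥(fthSubmodule G p)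

noncomputable instance : AddCommGroup (FTHAlgebra G p) :=
  inferInstanceAs (AddCommGroup ↥(fthSubmodule G p))

noncomputable instance : Module ℂ (FTHAlgebra G p) :=
  inferInstanceAs (Module ℂ ↥(fthSubmodule G p))

variable {G p}

/-- Evaluation of elements of `A_p(G)` at a point of `G`, as a linear functional. -/
noncomputable def FTHAlgebra.evalₗ (x : G) : FTHAlgebra G p →ₗ[ℂ] ℂ :=
  (LinearMap.proj x).comp (fthSubmodule G p).subtype

noncomputable instance : CoeFun (FTHAlgebra G p) (fun _ => G → ℂ) := ⟨fun f x => f.evalₗ x⟩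

/-- The norm of `A_p(G)`: the infimum of `∑ ‖ξₙ‖ ‖ηₙ‖` over all expansions. -/
noncomputable instance : Norm (FTHAlgebra G p) := ⟨fun f => sInf (fthCosts p f)⟩

theorem FTHAlgebra.norm_def (f : FTHAlgebra G p) : ‖f‖ = sInf (fthCosts p f) := rfl

theorem FTHAlgebra.norm_eval_le (f : FTHAlgebra G p) (x : G) : ‖f x‖ ≤ ‖f‖ := by
  rw [FTHAlgebra.norm_def]
  refine le_csInf f.2 ?_
  rintro r ⟨ξ, η, h, rfl⟩
  exact h.norm_le x

theorem FTHAlgebra.normCore : NormedSpace.Core ℂ (FTHAlgebra G p) where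
  toCore := seminormedSpaceCore_of_costs (fun f => fthCosts p f) (fun _ => rfl)
    (fun f => fthCosts_nonneg p f) (fun f => f.2)
    (fun f g => fthCosts_add p f g) (fun c f => fthCosts_smul p c f)
  norm_eq_zero_iff f := by
    constructor
    · intro h
      refine Subtype.ext (funext fun x => ?_)
      have := FTHAlgebra.norm_eval_le f x
      rw [h] at this
      exact norm_le_zero_iff.1 this
    · rintro rfl
      exact le_antisymm (csInf_le ⟨0, fun r hr => fthCosts_nonneg p _ r hr⟩ (fthCosts_zero p))
        (Real.sInf_nonneg fun r hr => fthCosts_nonneg p _ r hr)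

noncomputable instance : NormedAddCommGroup (FTHAlgebra G p) :=
  NormedAddCommGroup.ofCore FTHAlgebra.normCore

noncomputable instance : NormedSpace ℂ (FTHAlgebra G p) :=
  NormedSpace.ofCore FTHAlgebra.normCore

end FigaTalamancaHerz

/-! ### The projective tensor product -/

section Projective

/-- The algebraic tensor product `E ⊗ F`, to be equipped with the projective norm. -/
def AlgProjTensor (E F : Type*) [SeminormedAddCommGroup E] [NormedSpace ℂ E]
    [SeminormedAddCommGroup F] [NormedSpace ℂ F] : Type _ := E ⊗[ℂ] F

variable {E F : Type*} [SeminormedAddCommGroup E] [NormedSpace ℂ E]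
  [SeminormedAddCommGroup F] [NormedSpace ℂ F]

noncomputable instance : AddCommGroup (AlgProjTensor E F) :=
  inferInstanceAs (AddCommGroup (E ⊗[ℂ] F))

noncomputable instance : Module ℂ (AlgProjTensor E F) :=
  inferInstanceAs (Module ℂ (E ⊗[ℂ] F))

/-- The set of all `∑ ‖aᵢ‖ ‖bᵢ‖` over the finite expressions `u = ∑ aᵢ ⊗ bᵢ`. -/
def projCosts (u : E ⊗[ℂ] F) : Set ℝ :=
  {r | ∃ (n : ℕ) (a : Fin n → E) (b : Fin n → F),
    u = ∑ i, a i ⊗ₜ[ℂ] b i ∧ r = ∑ i, ‖a i‖ * ‖b i‖}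

theorem projCosts_nonneg (u : E ⊗[ℂ] F) (r : ℝ) (hr : r ∈ projCosts u) : 0 ≤ r := by
  obtain ⟨n, a, b, -, rfl⟩ := hr
  positivity

theorem projCosts_add (u v : E ⊗[ℂ] F) (r : ℝ) (hr : r ∈ projCosts u)
    (s : ℝ) (hs : s ∈ projCosts v) : r + s ∈ projCosts (u + v) := by
  obtain ⟨n, a, b, rfl, rfl⟩ := hr
  obtain ⟨m, a', b', rfl, rfl⟩ := hs
  exact ⟨n + m, Fin.append a a', Fin.append b b', by simp [Fin.sum_univ_add],
    by simp [Fin.sum_univ_add]⟩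

theorem projCosts_smul (c : ℂ) (u : E ⊗[ℂ] F) (r : ℝ) (hr : r ∈ projCosts u) :
    ‖c‖ * r ∈ projCosts (c • u) := by
  obtain ⟨n, a, b, rfl, rfl⟩ := hr
  refine ⟨n, fun i => c • a i, b, ?_, ?_⟩
  · simp [Finset.smul_sum, TensorProduct.smul_tmul']
  · simp [Finset.mul_sum, norm_smul, mul_assoc]

theorem projCosts_nonempty (u : E ⊗[ℂ] F) : (projCosts u).Nonempty := by
  induction u using TensorProduct.induction_on with
  | zero => exact ⟨0, 0, fun _ => 0, fun _ => 0, by simp, by simp⟩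
  | tmul a b => exact ⟨‖a‖ * ‖b‖, 1, fun _ => a, fun _ => b, by simp, by simp⟩
  | add u v hu hv =>
    obtain ⟨r, hr⟩ := hu
    obtain ⟨s, hs⟩ := hv
    exact ⟨r + s, projCosts_add u v r hr s hs⟩

/-- The projective norm `‖u‖ = inf {∑ ‖aᵢ‖ ‖bᵢ‖ : u = ∑ aᵢ ⊗ bᵢ}`. -/
noncomputable instance : Norm (AlgProjTensor E F) := ⟨fun u => sInf (projCosts (E := E) (F := F) u)⟩

theorem AlgProjTensor.norm_def (u : AlgProjTensor E F) :
    ‖u‖ = sInf (projCosts (E := E) (F := F) u) := rfl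

theorem AlgProjTensor.normCore : SeminormedSpace.Core ℂ (AlgProjTensor E F) :=
  seminormedSpaceCore_of_costs (fun u => projCosts (E := E) (F := F) u) (fun _ => rfl)
    (fun u => projCosts_nonneg u) (fun u => projCosts_nonempty u)
    (fun u v => projCosts_add u v) (fun c u => projCosts_smul c u)

noncomputable instance : SeminormedAddCommGroup (AlgProjTensor E F) :=
  SeminormedAddCommGroup.ofCore AlgProjTensor.normCore

noncomputable instance : NormedSpace ℂ (AlgProjTensor E F) where
  norm_smul_le c u := (AlgProjTensor.normCore.norm_smul c u).le

/-- The projective tensor product `E ⊗̂ F`: the completion of `E ⊗ F` in the projective norm. -/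
abbrev ProjTensor (E F : Type*) [SeminormedAddCommGroup E] [NormedSpace ℂ E]
    [SeminormedAddCommGroup F] [NormedSpace ℂ F] : Type _ :=
  UniformSpace.Completion (AlgProjTensor E F)

theorem AlgProjTensor.norm_lift_le (φ : E →L[ℂ] ℂ) (ψ : F →L[ℂ] ℂ) (u : AlgProjTensor E F) :
    ‖LinearMap.mul' ℂ ℂ (TensorProduct.map φ.toLinearMap ψ.toLinearMap u)‖ ≤
      ‖φ‖ * ‖ψ‖ * ‖u‖ := by
  have key : ∀ r ∈ projCosts (E := E) (F := F) u,
      ‖LinearMap.mul' ℂ ℂ (TensorProduct.map φ.toLinearMap ψ.toLinearMap u)‖ ≤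
        ‖φ‖ * ‖ψ‖ * r := by
    rintro r ⟨n, a, b, hu, rfl⟩
    rw [hu, map_sum, map_sum, Finset.mul_sum]
    refine norm_sum_le_of_le _ fun i _ => ?_
    rw [TensorProduct.map_tmul, LinearMap.mul'_apply, norm_mul]
    calc ‖φ (a i)‖ * ‖ψ (b i)‖ ≤ (‖φ‖ * ‖a i‖) * (‖ψ‖ * ‖b i‖) := by
          gcongr
          · exact φ.le_opNorm _
          · exact ψ.le_opNorm _
      _ = ‖φ‖ * ‖ψ‖ * (‖a i‖ * ‖b i‖) := by ring
  rcases (mul_nonneg (norm_nonneg φ) (norm_nonneg ψ)).eq_or_lt with h | h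
  · obtain ⟨r, hr⟩ := projCosts_nonempty (E := E) (F := F) u
    have := key r hr
    rw [← h, zero_mul] at this ⊢
    exact this
  · rw [← div_le_iff₀' h, AlgProjTensor.norm_def]
    refine le_csInf (projCosts_nonempty _) fun r hr => ?_
    rw [div_le_iff₀' h]
    exact key r hr

/-- `φ ⊗ ψ : a ⊗ b ↦ φ(a) ψ(b)` on the algebraic tensor product, for bounded functionals. -/
noncomputable def AlgProjTensor.functional (φ : E →L[ℂ] ℂ) (ψ : F →L[ℂ] ℂ) :
    AlgProjTensor E F →L[ℂ] ℂ :=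
  LinearMap.mkContinuous
    ((LinearMap.mul' ℂ ℂ).comp (TensorProduct.map φ.toLinearMap ψ.toLinearMap) :
      E ⊗[ℂ] F →ₗ[ℂ] ℂ) (‖φ‖ * ‖ψ‖) (AlgProjTensor.norm_lift_le φ ψ)

/-- The functional `φ ⊗ ψ` on `E ⊗̂ F`: the unique continuous extension. -/
noncomputable def ProjTensor.functional (φ : E →L[ℂ] ℂ) (ψ : F →L[ℂ] ℂ) :
    ProjTensor E F →L[ℂ] ℂ :=
  (AlgProjTensor.functional φ ψ).extend UniformSpace.Completion.toComplL

/-- The elementary tensor `a ⊗ b` in `E ⊗̂ F`. -/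
noncomputable def ProjTensor.tmul (a : E) (b : F) : ProjTensor E F :=
  UniformSpace.Completion.toComplL (𝕜 := ℂ) (E := AlgProjTensor E F) (a ⊗ₜ[ℂ] b : E ⊗[ℂ] F)

theorem ProjTensor.functional_coe (φ : E →L[ℂ] ℂ) (ψ : F →L[ℂ] ℂ) (u : AlgProjTensor E F) :
    ProjTensor.functional φ ψ (u : ProjTensor E F) = AlgProjTensor.functional φ ψ u :=
  ContinuousLinearMap.extend_eq (AlgProjTensor.functional φ ψ)
    (e := UniformSpace.Completion.toComplL) UniformSpace.Completion.denseRange_coe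
    (UniformSpace.Completion.isUniformInducing_coe _) u

theorem ProjTensor.functional_tmul (φ : E →L[ℂ] ℂ) (ψ : F →L[ℂ] ℂ) (a : E) (b : F) :
    ProjTensor.functional φ ψ (ProjTensor.tmul a b) = φ a * ψ b :=
  (ProjTensor.functional_coe φ ψ _).trans rfl

end Projective

/-! ### The Gelfand transform on `A_p(G) ⊗̂ A_q(H)` -/

section Gelfand

variable {G : Type*} [Group G] [TopologicalSpace G] [IsTopologicalGroup G]
  [LocallyCompactSpace G] [MeasurableSpace G] [BorelSpace G]
  {H : Type*} [Group H] [TopologicalSpace H] [IsTopologicalGroup H]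
  [LocallyCompactSpace H] [MeasurableSpace H] [BorelSpace H]
  {p q : ℝ} [Fact (1 < p)] [Fact (1 < q)]

/-- Evaluation at `x` as a bounded functional (a character) on `A_p(G)`. -/
noncomputable def FTHAlgebra.eval (x : G) : FTHAlgebra G p →L[ℂ] ℂ :=
  (FTHAlgebra.evalₗ x).mkContinuous 1 fun f => by
    simpa using FTHAlgebra.norm_eval_le f x

/-- The function on `G × H` given by an element of `A_p(G) ⊗̂ A_q(H)`, its Gelfand transform:
`(x, y) ↦ (ev_x ⊗ ev_y)(u)`, so that `a ⊗ b` becomes `(x, y) ↦ a(x) b(y)`. -/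
noncomputable def gelfandTransform (u : ProjTensor (FTHAlgebra G p) (FTHAlgebra H q)) :
    G × H → ℂ :=
  fun z => ProjTensor.functional (FTHAlgebra.eval z.1) (FTHAlgebra.eval z.2) u

theorem gelfandTransform_tmul (a : FTHAlgebra G p) (b : FTHAlgebra H q) (x : G) (y : H) :
    gelfandTransform (ProjTensor.tmul a b) (x, y) = a x * b y :=
  ProjTensor.functional_tmul _ _ a b

end Gelfand

/-! ### Representations -/

/-- An isometric representation of the group `Γ`, with topology `τ`, on the Banach space `E`: a
homomorphism into the invertible isometries of `E`, continuous for the strong operator topology. -/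
structure IsometricRep (Γ : Type*) [Group Γ] (τ : TopologicalSpace Γ) (E : Type*)
    [NormedAddCommGroup E] [NormedSpace ℂ E] [CompleteSpace E] where
  toHom : Γ →* (E ≃ₗᵢ[ℂ] E)
  continuous_toHom : ∀ η : E, Continuous fun γ => toHom γ η

/-! The function `ξ * η̌` is a coefficient of left translation on `L^{p'}(G)`, with vector `η` and
functional `ξ`. Hence a product of one such function of `x` and one of `y` is a coefficient of
translation in both variables on `L^{p'}(G; L^{q'}(H))`, taken at elementary tensors
(`dualPairing_biTranslation`). An absolutely convergent sum of these products becomes a single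
coefficient on `ℓ²(L^{p'}(G; L^{q'}(H)))`. Balancing the norms of vectors and functionals bounds
both by the square root of the total cost (`HasProductExpansion.exists_coefficient`). By density,
every element of the projective tensor product is approximated pointwise by coefficients of this one
representation.

A pointwise limit of coefficients with bounded data is a coefficient of the ultrapower
representation, at the class of the family of vectors and the limit of the functionals
(`exists_ultrapower_coefficient`). One ultrafilter handles both the net and the approximation error.

It remains to see that this ultrapower is uniformly convex. `UniformlyRotund r` is an inequality in
`r`-th powers of norms whose constant `K` depends only on `ε`. It can be integrated, so it passes to
`L^r`; it is closed, so it passes to ultrapowers and completions. For `r > 1` it is equivalent to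
uniform convexity, so the exponent can be changed between the nested spaces. -/

/-! ### Uniform convexity as an inequality between `r`-th powers -/

/-- A form of uniform convexity that passes to `L^r`-spaces by integration, and to limits. -/
def UniformlyRotund (r : ℝ) (X : Type*) [SeminormedAddCommGroup X] : Prop :=
  ∀ ε > 0, ∃ K, 0 ≤ K ∧ ∀ x y : X, ‖x - y‖ ^ r ≤
    ε * (‖x‖ ^ r + ‖y‖ ^ r) + K * ((‖x‖ ^ r + ‖y‖ ^ r) / 2 - (‖x + y‖ / 2) ^ r)

theorem midpoint_rpow_le {r : ℝ} (hr : 1 ≤ r) {X : Type*} [SeminormedAddCommGroup X] (x y : X) :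
    (‖x + y‖ / 2) ^ r ≤ (‖x‖ ^ r + ‖y‖ ^ r) / 2 := by
  have h1 : (‖x + y‖ / 2) ^ r ≤ ((‖x‖ + ‖y‖) / 2) ^ r := by
    gcongr
    exact norm_add_le x y
  have h2 := (convexOn_rpow hr).2 (norm_nonneg x) (norm_nonneg y)
    (by norm_num : (0 : ℝ) ≤ 1 / 2) (by norm_num : (0 : ℝ) ≤ 1 / 2) (by norm_num)
  simp only [smul_eq_mul] at h2
  have h3 : 1 / 2 * ‖x‖ + 1 / 2 * ‖y‖ = (‖x‖ + ‖y‖) / 2 := by ring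
  rw [h3] at h2
  linarith

theorem UniformlyRotund.uniformConvexSpace {r : ℝ} (hr : 1 ≤ r) {X : Type*}
    [SeminormedAddCommGroup X] (h : UniformlyRotund r X) : UniformConvexSpace X := by
  refine ⟨fun ε hε => ?_⟩
  have hεr : 0 < ε ^ r := Real.rpow_pos_of_pos hε r
  obtain ⟨K, hK, h⟩ := h (ε ^ r / 4) (by positivity)
  -- For unit vectors the choice `ε ^ r / 4` makes the first term `ε ^ r / 2`, so half of `ε ^ r`
  -- must come from the midpoint gap, which Bernoulli's inequality bounds by `r * (1 - ‖x + y‖ /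
  -- 2)`. `K + 1` replaces `K`, which may be zero.
  refine ⟨ε ^ r / ((K + 1) * r), by positivity, fun x hx y hy hxy => ?_⟩
  have h1 := h x y
  have h2 : ε ^ r ≤ ‖x - y‖ ^ r := by gcongr
  have hs : ‖x + y‖ ≤ 2 := by
    have := norm_add_le x y
    linarith
  have h3 := one_add_mul_self_le_rpow_one_add
    (show -1 ≤ ‖x + y‖ / 2 - 1 by linarith [norm_nonneg (x + y)]) hr
  rw [add_sub_cancel] at h3
  rw [hx, hy, Real.one_rpow] at h1
  have h4 : K * ((1 + 1) / 2 - (‖x + y‖ / 2) ^ r) ≤ (K + 1) * (r * (1 - ‖x + y‖ / 2)) := by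
    apply mul_le_mul <;> [linarith; linarith; skip; linarith]
    have : (‖x + y‖ / 2) ^ r ≤ 1 := Real.rpow_le_one (by positivity) (by linarith) (by linarith)
    linarith
  have h5 : ε ^ r / ((K + 1) * r) ≤ 2 - ‖x + y‖ := by
    rw [div_le_iff₀ (by positivity)]
    nlinarith
  linarith

/-- Two effects keep the gap positive: strict convexity of `t ^ r` when `‖y‖ < 1`, uniform convexity
of the norm when `‖y‖ = 1`. Compactness of `[0, 1]` makes the bound uniform in `‖y‖`. -/
theorem UniformConvexSpace.exists_midpoint_gap {r : ℝ} (hr : 1 < r) (X : Type*)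
    [SeminormedAddCommGroup X] [NormedSpace ℝ X] [UniformConvexSpace X] {ε : ℝ} (hε : 0 < ε) :
    ∃ m > 0, ∀ x y : X, ‖x‖ = 1 → ‖y‖ ≤ 1 → ε ≤ ‖x - y‖ →
      m ≤ (‖x‖ ^ r + ‖y‖ ^ r) / 2 - (‖x + y‖ / 2) ^ r := by
  obtain ⟨δ, hδ, hX⟩ := exists_forall_closed_ball_dist_add_le_two_sub X hε
  -- The cap at 1 keeps the base `1 - δ' / 2` below positive.
  set δ' := min δ 1 with hδ'
  have hδ'0 : 0 < δ' := lt_min hδ one_pos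
  have hδ'1 : δ' ≤ 1 := min_le_right _ _
  let g : ℝ → ℝ := fun t => (1 + t ^ r) / 2 - (min ((1 + t) / 2) (1 - δ' / 2)) ^ r
  have hg : Continuous g := by
    have h1 : Continuous fun t : ℝ => t ^ r := Real.continuous_rpow_const (by linarith)
    exact ((continuous_const.add h1).div_const 2).sub (h1.comp (by fun_prop))
  obtain ⟨t₀, ht₀, hmin⟩ := isCompact_Icc.exists_isMinOn (s := Set.Icc (0 : ℝ) 1)
    ⟨0, by simp⟩ hg.continuousOn
  refine ⟨g t₀, ?_, fun x y hx hy hxy => ?_⟩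
  · rcases ht₀.2.eq_or_lt with rfl | ht
    · have : min ((1 + 1 : ℝ) / 2) (1 - δ' / 2) = 1 - δ' / 2 := min_eq_right (by linarith)
      simp only [g, this, Real.one_rpow, gt_iff_lt]
      have : (1 - δ' / 2) ^ r < 1 := Real.rpow_lt_one (by linarith) (by linarith) (by linarith)
      linarith
    · have h2 := (strictConvexOn_rpow hr).2 (Set.mem_Ici.2 zero_le_one) (Set.mem_Ici.2 ht₀.1) ht.ne'
        (by norm_num : (0 : ℝ) < 1 / 2) (by norm_num : (0 : ℝ) < 1 / 2) (by norm_num)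
      simp only [smul_eq_mul, Real.one_rpow] at h2
      have h3 : 1 / 2 * 1 + 1 / 2 * t₀ = (1 + t₀) / 2 := by ring
      rw [h3] at h2
      have h4 : (min ((1 + t₀) / 2) (1 - δ' / 2)) ^ r ≤ ((1 + t₀) / 2) ^ r := by
        refine Real.rpow_le_rpow (le_min ?_ ?_) (min_le_left _ _) (by linarith) <;>
          linarith [ht₀.1]
      simp only [g, gt_iff_lt]
      linarith
  · refine (hmin (show ‖y‖ ∈ Set.Icc (0 : ℝ) 1 from ⟨norm_nonneg y, hy⟩)).trans ?_
    simp only [g, hx, Real.one_rpow]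
    gcongr
    have h1 := norm_add_le x y
    have h2 := hX hx.le hy hxy
    have h3 : δ' ≤ δ := min_le_left _ _
    refine le_min ?_ ?_ <;> linarith

/-- By symmetry and homogeneity the longer vector may be scaled to norm 1. If `‖x - y‖` is small
relative to `‖x‖`, the `ε` term suffices; otherwise the gap is at least `m * ‖x‖ ^ r`, while `‖x -
y‖ ^ r ≤ (2 * ‖x‖) ^ r`, whence `K = 2 ^ r / m`. -/
theorem UniformConvexSpace.uniformlyRotund {r : ℝ} (hr : 1 < r) (X : Type*)
    [SeminormedAddCommGroup X] [NormedSpace ℝ X] [UniformConvexSpace X] :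
    UniformlyRotund r X := by
  intro ε hε
  have hε' : 0 < ε ^ r⁻¹ := Real.rpow_pos_of_pos hε _
  obtain ⟨m, hm, h⟩ := UniformConvexSpace.exists_midpoint_gap hr X hε'
  have key : ∀ x y : X, ‖y‖ ≤ ‖x‖ → ‖x - y‖ ^ r ≤ ε * (‖x‖ ^ r + ‖y‖ ^ r) +
      2 ^ r / m * ((‖x‖ ^ r + ‖y‖ ^ r) / 2 - (‖x + y‖ / 2) ^ r) := by
    intro x y hyx
    have hmid := midpoint_rpow_le hr.le x y
    have hK : 0 ≤ 2 ^ r / m * ((‖x‖ ^ r + ‖y‖ ^ r) / 2 - (‖x + y‖ / 2) ^ r) :=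
      mul_nonneg (by positivity) (by linarith)
    by_cases hxy : ‖x - y‖ ≤ ε ^ r⁻¹ * ‖x‖
    · have h1 : ‖x - y‖ ^ r ≤ ε * ‖x‖ ^ r := by
        calc ‖x - y‖ ^ r ≤ (ε ^ r⁻¹ * ‖x‖) ^ r := by gcongr
          _ = ε * ‖x‖ ^ r := by
            rw [Real.mul_rpow hε'.le (norm_nonneg x), Real.rpow_inv_rpow hε.le (by linarith)]
      have h2 : 0 ≤ ε * ‖y‖ ^ r := by positivity
      linarith
    · push Not at hxy
      have hx : 0 < ‖x‖ := by
        by_contra hx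
        have hx0 : ‖x‖ = 0 := le_antisymm (not_lt.1 hx) (norm_nonneg x)
        have := norm_sub_le x y
        rw [hx0, mul_zero] at hxy
        linarith
      set c := ‖x‖ with hc
      have hn : ∀ z : X, ‖c⁻¹ • z‖ = ‖z‖ / c := fun z => by
        rw [norm_smul_of_nonneg (inv_nonneg.2 hx.le), div_eq_inv_mul]
      have h1 := h (c⁻¹ • x) (c⁻¹ • y) (by rw [hn]; exact div_self hx.ne')
        (by rw [hn]; exact (div_le_one hx).2 hyx)
        (by rw [← smul_sub, hn, le_div_iff₀ hx]; exact hxy.le)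
      rw [← smul_add, hn, hn, hn, div_right_comm ‖x + y‖,
        Real.div_rpow (norm_nonneg _) hx.le, Real.div_rpow (norm_nonneg _) hx.le,
        Real.div_rpow (by positivity) hx.le] at h1
      have hcr : 0 < c ^ r := Real.rpow_pos_of_pos hx r
      have h2 : m * c ^ r ≤ (‖x‖ ^ r + ‖y‖ ^ r) / 2 - (‖x + y‖ / 2) ^ r := by
        calc m * c ^ r ≤ ((‖x‖ ^ r / c ^ r + ‖y‖ ^ r / c ^ r) / 2 -
              (‖x + y‖ / 2) ^ r / c ^ r) * c ^ r := by gcongr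
          _ = _ := by field_simp
      have h3 : ‖x - y‖ ^ r ≤ (2 * c) ^ r := by
        have := norm_sub_le x y
        gcongr
        linarith
      rw [Real.mul_rpow zero_le_two hx.le] at h3
      have h4 : 2 ^ r * c ^ r ≤
          2 ^ r / m * ((‖x‖ ^ r + ‖y‖ ^ r) / 2 - (‖x + y‖ / 2) ^ r) := by
        calc (2 : ℝ) ^ r * c ^ r = 2 ^ r / m * (m * c ^ r) := by field_simp
          _ ≤ _ := by gcongr
      have h5 : 0 ≤ ε * (‖x‖ ^ r + ‖y‖ ^ r) := by positivity
      linarith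
  refine ⟨2 ^ r / m, by positivity, fun x y => ?_⟩
  rcases le_total ‖y‖ ‖x‖ with hyx | hxy
  · exact key x y hyx
  · have := key y x hxy
    rwa [norm_sub_rev, add_comm y x, add_comm (‖y‖ ^ r)] at this

/-! ### Stability of rotundity under `L^r` and completion. -/

theorem MeasureTheory.Lp.norm_rpow_eq_integral {α E : Type*} [MeasurableSpace α] {μ : Measure α}
    [NormedAddCommGroup E] {r : ℝ} (hr : 0 < r) (f : Lp E (ENNReal.ofReal r) μ) :
    ‖f‖ ^ r = ∫ a, ‖f a‖ ^ r ∂μ := by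
  have h0 : 0 ≤ ∫ a, ‖f a‖ ^ r ∂μ := integral_nonneg fun a => by positivity
  rw [Lp.norm_def, (Lp.memLp f).eLpNorm_eq_integral_rpow_norm (by simpa using hr)
    ENNReal.ofReal_ne_top, ENNReal.toReal_ofReal hr.le,
    ENNReal.toReal_ofReal (Real.rpow_nonneg h0 _), Real.rpow_inv_rpow h0 hr.ne']

theorem MeasureTheory.Lp.integrable_norm_rpow_ofReal {α E : Type*} [MeasurableSpace α]
    {μ : Measure α} [NormedAddCommGroup E] {r : ℝ} (hr : 0 < r) (f : Lp E (ENNReal.ofReal r) μ) :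
    Integrable (fun a => ‖f a‖ ^ r) μ := by
  have := (Lp.memLp f).integrable_norm_rpow (by simpa using hr) ENNReal.ofReal_ne_top
  rwa [ENNReal.toReal_ofReal hr.le] at this

/-- The inequality is linear in `r`-th powers of norms, so integrating it pointwise gives the same
inequality for `L^r` norms, with the same `K`. -/
theorem UniformlyRotund.lp {α E : Type*} [MeasurableSpace α] (μ : Measure α)
    [NormedAddCommGroup E] {r : ℝ} [hr : Fact (1 < r)] (h : UniformlyRotund r E) :
    UniformlyRotund r (Lp E (ENNReal.ofReal r) μ) := by
  have hr0 : 0 < r := one_pos.trans hr.out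
  intro ε hε
  obtain ⟨K, hK, h⟩ := h ε hε
  refine ⟨K, hK, fun x y => ?_⟩
  rw [Real.div_rpow (norm_nonneg _) zero_le_two]
  simp only [Lp.norm_rpow_eq_integral hr0]
  have ix := Lp.integrable_norm_rpow_ofReal hr0 x
  have iy := Lp.integrable_norm_rpow_ofReal hr0 y
  have ia := Lp.integrable_norm_rpow_ofReal hr0 (x + y)
  have i1 := (ix.add iy).const_mul ε
  have i2 := ((ix.add iy).div_const 2)
  have i3 := (i2.sub (ia.div_const (2 ^ r))).const_mul K
  simp only [Pi.add_apply, Pi.sub_apply] at i1 i2 i3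
  rw [← integral_add ix iy, ← integral_const_mul, ← integral_div, ← integral_div,
    ← integral_sub i2 (ia.div_const _), ← integral_const_mul, ← integral_add i1 i3]
  refine integral_mono_ae (Lp.integrable_norm_rpow_ofReal hr0 _) (i1.add i3) ?_
  filter_upwards [Lp.coeFn_sub x y, Lp.coeFn_add x y] with a h1 h2
  rw [h1, Pi.sub_apply, h2, Pi.add_apply,
    ← Real.div_rpow (norm_nonneg _) zero_le_two]
  exact h _ _

theorem UniformlyRotund.completion {r : ℝ} (hr : 0 ≤ r) {X : Type*} [SeminormedAddCommGroup X]
    (h : UniformlyRotund r X) : UniformlyRotund r (UniformSpace.Completion X) := by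
  intro ε hε
  obtain ⟨K, hK, h⟩ := h ε hε
  refine ⟨K, hK, fun x y => ?_⟩
  have hc : Continuous fun t : ℝ => t ^ r := Real.continuous_rpow_const hr
  induction x, y using UniformSpace.Completion.induction_on₂ with
  | hp =>
    have h1 := hc.comp (continuous_fst (X := UniformSpace.Completion X)
      (Y := UniformSpace.Completion X)).norm
    have h2 := hc.comp (continuous_snd (X := UniformSpace.Completion X)
      (Y := UniformSpace.Completion X)).norm
    have h3 := hc.comp (continuous_fst.sub (continuous_snd (X := UniformSpace.Completion X)
      (Y := UniformSpace.Completion X))).norm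
    have h4 := hc.comp ((continuous_fst.add (continuous_snd (X := UniformSpace.Completion X)
      (Y := UniformSpace.Completion X))).norm.div_const 2)
    exact isClosed_le h3
      (((h1.add h2).const_mul ε).add ((((h1.add h2).div_const 2).sub h4).const_mul K))
  | ih a b =>
    rw [← UniformSpace.Completion.coe_sub, ← UniformSpace.Completion.coe_add]
    simpa only [UniformSpace.Completion.norm_coe] using h a b

/-! ### Ultrapowers -/

section Ultrapower

theorem Ultrafilter.tendsto_limUnder_of_norm_le {I : Type*} (U : Ultrafilter I) {Y : Type*}
    [SeminormedAddCommGroup Y] [ProperSpace Y] {s : I → Y} {C : ℝ} (hs : ∀ i, ‖s i‖ ≤ C) :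
    Tendsto s U (𝓝 (limUnder U s)) := by
  obtain ⟨l, -, hl⟩ := (isCompact_closedBall (0 : Y) C).ultrafilter_le_nhds (U.map s)
    (by
      refine le_principal_iff.2 (mem_map.2 (univ_mem' fun i => ?_))
      simpa using hs i)
  exact tendsto_nhds_limUnder ⟨l, hl⟩

/-- The norm-bounded families `I → X`. -/
def boundedFamilies (I : Type w) (X : Type u) [SeminormedAddCommGroup X] [NormedSpace ℂ X] :
    Submodule ℂ (I → X) where
  carrier := {s | ∃ C : ℝ, ∀ i, ‖s i‖ ≤ C}
  zero_mem' := ⟨0, fun i => by simp⟩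
  add_mem' := fun ⟨C, hC⟩ ⟨D, hD⟩ => ⟨C + D, fun i => norm_add_le_of_le (hC i) (hD i)⟩
  smul_mem' := fun c _ ⟨C, hC⟩ => ⟨‖c‖ * C, fun i => by
    rw [Pi.smul_apply, norm_smul]
    exact mul_le_mul_of_nonneg_left (hC i) (norm_nonneg c)⟩

/-- The norm-bounded families `I → X`, seminormed by the limit of the norms along an
ultrafilter. The ultrapower of `X` is its completion. -/
def PreUltrapower {I : Type w} (_ : Ultrafilter I) (X : Type u) [SeminormedAddCommGroup X]
    [NormedSpace ℂ X] : Type (max u w) := ↥(boundedFamilies I X)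

variable {I : Type w} {U : Ultrafilter I} {X : Type u} [SeminormedAddCommGroup X]
  [NormedSpace ℂ X]

noncomputable instance : AddCommGroup (PreUltrapower U X) :=
  inferInstanceAs (AddCommGroup ↥(boundedFamilies I X))

noncomputable instance : Module ℂ (PreUltrapower U X) :=
  inferInstanceAs (Module ℂ ↥(boundedFamilies I X))

noncomputable instance : Norm (PreUltrapower U X) := ⟨fun s => limUnder U fun i => ‖s.1 i‖⟩

theorem PreUltrapower.tendsto_norm (s : PreUltrapower U X) :
    Tendsto (fun i => ‖s.1 i‖) U (𝓝 ‖s‖) := by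
  obtain ⟨C, hC⟩ := s.2
  exact U.tendsto_limUnder_of_norm_le (C := C) fun i => by simpa using hC i

theorem PreUltrapower.normCore : SeminormedSpace.Core ℂ (PreUltrapower U X) where
  norm_nonneg s := ge_of_tendsto' s.tendsto_norm fun i => norm_nonneg _
  norm_smul c s := tendsto_nhds_unique (c • s).tendsto_norm <| by
    refine (s.tendsto_norm.const_mul ‖c‖).congr fun i => ?_
    exact (norm_smul c (s.1 i)).symm
  norm_triangle s t := le_of_tendsto_of_tendsto' (s + t).tendsto_norm
    (s.tendsto_norm.add t.tendsto_norm) fun i => norm_add_le (s.1 i) (t.1 i)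

noncomputable instance : SeminormedAddCommGroup (PreUltrapower U X) :=
  SeminormedAddCommGroup.ofCore PreUltrapower.normCore

noncomputable instance : NormedSpace ℂ (PreUltrapower U X) where
  norm_smul_le c s := (PreUltrapower.normCore.norm_smul c s).le

/-- The same `K` serves every index, so the inequality survives the limit along the ultrafilter. -/
theorem UniformlyRotund.preUltrapower {r : ℝ} (hr : 0 ≤ r) (h : UniformlyRotund r X) :
    UniformlyRotund r (PreUltrapower U X) := by
  intro ε hε
  obtain ⟨K, hK, h⟩ := h ε hε
  refine ⟨K, hK, fun s t => ?_⟩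
  have hp : ∀ {g : I → ℝ} {l : ℝ}, Tendsto g U (𝓝 l) → Tendsto (fun i => g i ^ r) U (𝓝 (l ^ r)) :=
    fun hg => ((Real.continuous_rpow_const hr).tendsto _).comp hg
  have hst := (hp s.tendsto_norm).add (hp t.tendsto_norm)
  exact le_of_tendsto_of_tendsto' (hp (s - t).tendsto_norm)
    ((hst.const_mul ε).add (((hst.div_const 2).sub
      (hp ((s + t).tendsto_norm.div_const 2))).const_mul K)) fun i => h (s.1 i) (t.1 i)

/-- The operator on families induced by a linear isometry, applied in each index. -/
noncomputable def PreUltrapower.map (U : Ultrafilter I) (T : X →ₗᵢ[ℂ] X) :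
    PreUltrapower U X →ₗᵢ[ℂ] PreUltrapower U X where
  toFun s := ⟨fun i => T (s.1 i), by simpa [boundedFamilies] using s.2⟩
  map_add' s t := Subtype.ext (funext fun i => map_add T (s.1 i) (t.1 i))
  map_smul' c s := Subtype.ext (funext fun i => map_smul T c (s.1 i))
  norm_map' s := tendsto_nhds_unique (PreUltrapower.tendsto_norm _)
    (s.tendsto_norm.congr fun i => (T.norm_map (s.1 i)).symm)

/-- Bounded scalars converge along an ultrafilter, and the limit is linear in the family. `B` only
secures existence of the limits; the norm bound is the limit `c₀` of the individual bounds, which is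
what gives the sharp constant. -/
theorem PreUltrapower.exists_functional (U : Ultrafilter I) (ξ : I → StrongDual ℂ X)
    (c : I → ℝ) (hξ : ∀ i, ‖ξ i‖ ≤ c i) (B : ℝ) (hB : ∀ i, c i ≤ B) (c₀ : ℝ)
    (hc : Tendsto c U (𝓝 c₀)) :
    ∃ Ξ : PreUltrapower U X →L[ℂ] ℂ, (∀ s, ‖Ξ s‖ ≤ c₀ * ‖s‖) ∧
      ∀ s, Tendsto (fun i => ξ i (s.1 i)) U (𝓝 (Ξ s)) :=
  have hlim : ∀ s : PreUltrapower U X,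
      Tendsto (fun i => ξ i (s.1 i)) U (𝓝 (limUnder U fun i => ξ i (s.1 i))) := fun s => by
    obtain ⟨C, hC⟩ := s.2
    refine U.tendsto_limUnder_of_norm_le (C := B * C) fun i => ?_
    exact (ξ i).le_of_opNorm_le_of_le ((hξ i).trans (hB i)) (hC i)
  have hle : ∀ s : PreUltrapower U X, ‖limUnder U fun i => ξ i (s.1 i)‖ ≤ c₀ * ‖s‖ := fun s =>
    le_of_tendsto_of_tendsto' (hlim s).norm (hc.mul s.tendsto_norm) fun i =>
      (ξ i).le_of_opNorm_le (hξ i) _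
  ⟨LinearMap.mkContinuous
    { toFun := fun s => limUnder U fun i => ξ i (s.1 i)
      map_add' := fun s t => tendsto_nhds_unique (hlim (s + t))
        (((hlim s).add (hlim t)).congr fun i => (map_add (ξ i) (s.1 i) (t.1 i)).symm)
      map_smul' := fun a s => tendsto_nhds_unique (hlim (a • s))
        (((hlim s).const_mul a).congr fun i => (map_smul (ξ i) a (s.1 i)).symm) } c₀ hle,
    hle, hlim⟩

/-- The identities extend from the dense image by continuity. Invertibility need not be assumed: `ρ
γ⁻¹` supplies the inverse. Completion also divides out the vectors of seminorm zero. -/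
theorem LinearIsometryEquiv.exists_completion_hom (Y : Type*) [SeminormedAddCommGroup Y]
    [NormedSpace ℂ Y] {Γ : Type*} [Group Γ] (ρ : Γ → Y →ₗᵢ[ℂ] Y) (h1 : ∀ y, ρ 1 y = y)
    (hmul : ∀ a b y, ρ (a * b) y = ρ a (ρ b y)) :
    ∃ π : Γ →* (UniformSpace.Completion Y ≃ₗᵢ[ℂ] UniformSpace.Completion Y),
      ∀ γ (y : Y), π γ y = ρ γ y :=
  let T : Γ → UniformSpace.Completion Y →L[ℂ] UniformSpace.Completion Y := fun γ =>
    (ρ γ).toContinuousLinearMap.completion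
  have hT : ∀ γ (y : Y), T γ y = ρ γ y := fun γ y =>
    (ρ γ).toContinuousLinearMap.completion_apply_coe y
  have hone : ∀ z, T 1 z = z := fun z => by
    induction z using UniformSpace.Completion.induction_on with
    | hp => exact isClosed_eq (T 1).continuous continuous_id
    | ih y => rw [hT, h1]
  have hmulT : ∀ a b z, T (a * b) z = T a (T b z) := fun a b z => by
    induction z using UniformSpace.Completion.induction_on with
    | hp => exact isClosed_eq (T _).continuous ((T a).continuous.comp (T b).continuous)
    | ih y => rw [hT, hT, hT, hmul]
  have hnorm : ∀ a z, ‖T a z‖ = ‖z‖ := fun a z => by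
    induction z using UniformSpace.Completion.induction_on with
    | hp => exact isClosed_eq (T a).continuous.norm continuous_norm
    | ih y => rw [hT, UniformSpace.Completion.norm_coe, UniformSpace.Completion.norm_coe,
        LinearIsometry.norm_map]
  let π : Γ → (UniformSpace.Completion Y ≃ₗᵢ[ℂ] UniformSpace.Completion Y) := fun γ =>
    { toLinearEquiv := LinearEquiv.ofLinearMap (T γ).toLinearMap (T γ⁻¹).toLinearMap
        (LinearMap.ext fun z => by simpa [hone] using (hmulT γ γ⁻¹ z).symm)
        (LinearMap.ext fun z => by simpa [hone] using (hmulT γ⁻¹ γ z).symm)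
      norm_map' := hnorm γ }
  ⟨{ toFun := π
     map_one' := LinearIsometryEquiv.ext hone
     map_mul' := fun a b => LinearIsometryEquiv.ext (hmulT a b) }, hT⟩

theorem exists_ultrapower_coefficient {Γ : Type*} [Group Γ] (U : Ultrafilter I)
    (hX : UniformlyRotund 2 X) (ρ : Γ → X →ₗᵢ[ℂ] X) (h1 : ∀ x, ρ 1 x = x)
    (hmul : ∀ a b x, ρ (a * b) x = ρ a (ρ b x))
    (η : I → X) (ξ : I → StrongDual ℂ X) (c : I → ℝ) (hη : ∀ i, ‖η i‖ ≤ c i)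
    (hξ : ∀ i, ‖ξ i‖ ≤ c i) (B : ℝ) (hB : ∀ i, c i ≤ B) (c₀ : ℝ) (hc : Tendsto c U (𝓝 c₀))
    (f : Γ → ℂ) (hf : ∀ γ, Tendsto (fun i => ξ i (ρ γ (η i))) U (𝓝 (f γ))) :
    ∃ (E : Type (max u w)) (_ : NormedAddCommGroup E) (_ : NormedSpace ℂ E) (_ : CompleteSpace E)
      (_ : UniformConvexSpace E) (π : Γ →* (E ≃ₗᵢ[ℂ] E)) (η : E) (ξ : StrongDual ℂ E),
      ‖η‖ ≤ c₀ ∧ ‖ξ‖ ≤ c₀ ∧ ∀ γ, f γ = ξ (π γ η) := by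
  obtain ⟨Ξ, hΞ, hlim⟩ := PreUltrapower.exists_functional (X := X) U ξ c hξ B hB c₀ hc
  have hc0 : 0 ≤ c₀ := ge_of_tendsto' hc fun i => (norm_nonneg _).trans (hη i)
  obtain ⟨π, hπ⟩ := LinearIsometryEquiv.exists_completion_hom (PreUltrapower U X)
    (fun γ => PreUltrapower.map U (ρ γ)) (fun s => Subtype.ext (funext fun i => h1 (s.1 i)))
    (fun a b s => Subtype.ext (funext fun i => hmul a b (s.1 i)))
  let s : PreUltrapower U X := ⟨η, B, fun i => (hη i).trans (hB i)⟩
  refine ⟨UniformSpace.Completion (PreUltrapower U X), inferInstance, inferInstance, inferInstance,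
    ((hX.preUltrapower zero_le_two).completion zero_le_two).uniformConvexSpace one_le_two, π, s,
    Ξ.fromCompletion, ?_, ContinuousLinearMap.opNorm_le_bound _ hc0 fun z => ?_, fun γ => ?_⟩
  · rw [UniformSpace.Completion.norm_coe]
    exact le_of_tendsto_of_tendsto' s.tendsto_norm hc hη
  · induction z using UniformSpace.Completion.induction_on with
    | hp =>
      exact isClosed_le Ξ.fromCompletion.continuous.norm (continuous_const.mul continuous_norm)
    | ih y =>
      rw [ContinuousLinearMap.fromCompletion_apply_coe, UniformSpace.Completion.norm_coe]
      exact hΞ y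
  · rw [hπ, ContinuousLinearMap.fromCompletion_apply_coe]
    exact tendsto_nhds_unique (hf γ) (hlim (PreUltrapower.map U (ρ γ) s))

end Ultrapower

/-! ### Vector-valued `L^p`-spaces: isometries, elementary tensors and functionals -/

section VectorValuedLp

namespace MeasureTheory.Lp

variable {α : Type*} [MeasurableSpace α] {μ : Measure α} {a b : ℝ≥0∞}
  {E : Type*} [NormedAddCommGroup E] [NormedSpace ℂ E]

/-- The elementary tensor `v ⊗ w : s ↦ v(s) w` in `L^b(μ; E)`. -/
noncomputable def tensor (v : Lp ℂ b μ) (w : E) : Lp E b μ :=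
  (ContinuousLinearMap.toSpanSingleton ℂ w).compLp v

theorem coeFn_tensor (v : Lp ℂ b μ) (w : E) : ∀ᵐ s ∂μ, tensor v w s = v s • w :=
  (ContinuousLinearMap.toSpanSingleton ℂ w).coeFn_compLp v

theorem norm_tensor_le (v : Lp ℂ b μ) (w : E) : ‖tensor v w‖ ≤ ‖v‖ * ‖w‖ := by
  refine ((ContinuousLinearMap.toSpanSingleton ℂ w).norm_compLp_le v).trans ?_
  rw [ContinuousLinearMap.norm_toSpanSingleton, mul_comm]

theorem compMeasurePreserving_tensor {f : α → α} (hf : MeasurePreserving f μ μ)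
    (v : Lp ℂ b μ) (w : E) :
    compMeasurePreserving f hf (tensor v w) = tensor (compMeasurePreserving f hf v) w := by
  refine Lp.ext ?_
  filter_upwards [coeFn_compMeasurePreserving (tensor v w) hf, coeFn_compMeasurePreserving v hf,
    hf.quasiMeasurePreserving.ae (coeFn_tensor v w),
    coeFn_tensor (compMeasurePreserving f hf v) w] with s h1 h2 h3 h4
  rw [h1, h4, h2, Function.comp_apply, h3, Function.comp_apply]

/-- The pointwise action of a linear isometry of `E` on `L^b(μ; E)`. -/
noncomputable def mapIsometry (b : ℝ≥0∞) [Fact (1 ≤ b)] (μ : Measure α) (T : E →ₗᵢ[ℂ] E) :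
    Lp E b μ →ₗᵢ[ℂ] Lp E b μ where
  toLinearMap := T.toContinuousLinearMap.compLpₗ b μ
  norm_map' F := by
    rw [ContinuousLinearMap.compLpₗ_apply, Lp.norm_def, Lp.norm_def]
    congr 1
    refine eLpNorm_congr_norm_ae ?_
    filter_upwards [T.toContinuousLinearMap.coeFn_compLp F] with s hs
    rw [hs]
    exact T.norm_map _

variable [Fact (1 ≤ b)]

theorem coeFn_mapIsometry (T : E →ₗᵢ[ℂ] E) (F : Lp E b μ) :
    ∀ᵐ s ∂μ, mapIsometry b μ T F s = T (F s) :=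
  T.toContinuousLinearMap.coeFn_compLp F

theorem mapIsometry_eq_self {T : E →ₗᵢ[ℂ] E} (hT : ∀ x, T x = x) (F : Lp E b μ) :
    mapIsometry b μ T F = F := by
  refine Lp.ext ?_
  filter_upwards [coeFn_mapIsometry T F] with s hs
  rw [hs, hT]

theorem mapIsometry_comp {T S R : E →ₗᵢ[ℂ] E} (h : ∀ x, R x = T (S x)) (F : Lp E b μ) :
    mapIsometry b μ R F = mapIsometry b μ T (mapIsometry b μ S F) := by
  refine Lp.ext ?_
  filter_upwards [coeFn_mapIsometry R F, coeFn_mapIsometry S F,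
    coeFn_mapIsometry T (mapIsometry b μ S F)] with s h1 h2 h3
  rw [h1, h3, h2, h]

theorem mapIsometry_compMeasurePreserving (T : E →ₗᵢ[ℂ] E) {f : α → α}
    (hf : MeasurePreserving f μ μ) (F : Lp E b μ) :
    mapIsometry b μ T (compMeasurePreserving f hf F) =
      compMeasurePreserving f hf (mapIsometry b μ T F) := by
  refine Lp.ext ?_
  filter_upwards [coeFn_mapIsometry T (compMeasurePreserving f hf F),
    coeFn_compMeasurePreserving F hf, coeFn_compMeasurePreserving (mapIsometry b μ T F) hf,
    hf.quasiMeasurePreserving.ae (coeFn_mapIsometry T F)] with s h1 h2 h3 h4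
  rw [h1, h2, h3, Function.comp_apply, Function.comp_apply, h4]

theorem mapIsometry_tensor (T : E →ₗᵢ[ℂ] E) (v : Lp ℂ b μ) (w : E) :
    mapIsometry b μ T (tensor v w) = tensor v (T w) := by
  refine Lp.ext ?_
  filter_upwards [coeFn_mapIsometry T (tensor v w), coeFn_tensor v w, coeFn_tensor v (T w)]
    with s h1 h2 h3
  rw [h1, h2, h3, map_smul]

variable [Fact (1 ≤ a)] [ENNReal.HolderConjugate a b]

/-- The functional `F ↦ ∫ Φ(s)(F(s)) ds` on `L^b(μ; E)` given by `Φ ∈ L^a(μ; E*)`. -/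
noncomputable def dualPairing (b : ℝ≥0∞) [Fact (1 ≤ b)] [ENNReal.HolderConjugate a b]
    (Φ : Lp (StrongDual ℂ E) a μ) : StrongDual ℂ (Lp E b μ) :=
  (ContinuousLinearMap.id ℂ (StrongDual ℂ E)).lpPairing μ a b Φ

theorem dualPairing_apply (Φ : Lp (StrongDual ℂ E) a μ) (F : Lp E b μ) :
    dualPairing b Φ F = ∫ s, Φ s (F s) ∂μ :=
  (ContinuousLinearMap.id ℂ (StrongDual ℂ E)).lpPairing_eq_integral Φ F

/-- Hölder's inequality with constant 1. Only this easy embedding of `L^a(E*)` into the dual of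
`L^b(E)` is needed, not a description of the whole dual. -/
theorem norm_dualPairing_le (Φ : Lp (StrongDual ℂ E) a μ) : ‖dualPairing b Φ‖ ≤ ‖Φ‖ := by
  refine ContinuousLinearMap.opNorm_le_bound _ (norm_nonneg _) fun F => ?_
  have h1 : dualPairing b Φ F =
      L1.integral ((ContinuousLinearMap.id ℂ (StrongDual ℂ E)).holder 1 Φ F) := by
    rw [L1.integral_eq_integral, dualPairing_apply]
    exact integral_congr_ae ((ContinuousLinearMap.id ℂ (StrongDual ℂ E)).coeFn_holder Φ F).symm
  rw [h1]
  refine (L1.norm_integral_le _).trans ?_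
  refine (ContinuousLinearMap.norm_holder_apply_apply_le _ Φ F).trans ?_
  have := ContinuousLinearMap.norm_id_le (𝕜 := ℂ) (E := StrongDual ℂ E)
  calc _ ≤ 1 * ‖Φ‖ * ‖F‖ := by gcongr
    _ = _ := by rw [one_mul]

theorem dualPairing_tensor (φ : Lp ℂ a μ) (ψ : StrongDual ℂ E) (v : Lp ℂ b μ) (w : E) :
    dualPairing b (tensor φ ψ) (tensor v w) = (∫ s, φ s * v s ∂μ) * ψ w := by
  rw [dualPairing_apply, ← integral_mul_const]
  refine integral_congr_ae ?_
  filter_upwards [coeFn_tensor φ ψ, coeFn_tensor v w] with s h1 h2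
  rw [h1, h2, map_smul, smul_apply, smul_eq_mul, smul_eq_mul]
  ring

/-- The functional `F ↦ ∫ φ(s) F(s) ds` on `L^b(μ)` given by `φ ∈ L^a(μ)`. -/
noncomputable def scalarDualPairing (b : ℝ≥0∞) [Fact (1 ≤ b)] [ENNReal.HolderConjugate a b]
    (φ : Lp ℂ a μ) : StrongDual ℂ (Lp ℂ b μ) :=
  dualPairing b (tensor φ (ContinuousLinearMap.id ℂ ℂ))

theorem scalarDualPairing_apply (φ : Lp ℂ a μ) (v : Lp ℂ b μ) :
    scalarDualPairing b φ v = ∫ s, φ s * v s ∂μ := by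
  rw [scalarDualPairing, dualPairing_apply]
  refine integral_congr_ae ?_
  filter_upwards [coeFn_tensor φ (ContinuousLinearMap.id ℂ ℂ)] with s h1
  rw [h1, smul_apply, ContinuousLinearMap.id_apply, smul_eq_mul]

theorem norm_scalarDualPairing_le (φ : Lp ℂ a μ) : ‖scalarDualPairing b φ‖ ≤ ‖φ‖ := by
  refine (norm_dualPairing_le _).trans ((norm_tensor_le _ _).trans ?_)
  exact mul_le_of_le_one_right (norm_nonneg _) ContinuousLinearMap.norm_id_le

end MeasureTheory.Lp

/-! ### Square-summable sequences -/

instance fact_one_lt_two_real : Fact ((1 : ℝ) < 2) := ⟨one_lt_two⟩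

instance holderConjugate_ofReal_two :
    ENNReal.HolderConjugate (ENNReal.ofReal 2) (ENNReal.ofReal 2) :=
  Real.HolderConjugate.two_two.ennrealOfReal

/-- The square-summable sequences in `E`. -/
abbrev SqSummableSeq (E : Type*) [NormedAddCommGroup E] : Type _ :=
  Lp E (ENNReal.ofReal 2) (Measure.count : Measure ℕ)

theorem exists_sqSummableSeq {E : Type*} [NormedAddCommGroup E] (x : ℕ → E) (c : ℕ → ℝ)
    (hc : Summable c) (hx : ∀ n, ‖x n‖ ^ 2 ≤ c n) :
    ∃ F : SqSummableSeq E, (∀ n, F n = x n) ∧ ‖F‖ ^ 2 ≤ ∑' n, c n := by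
  have hs : Summable fun n => ‖x n‖ ^ 2 := hc.of_nonneg_of_le (fun n => by positivity) hx
  have hi : Integrable (fun n => ‖x n‖ ^ 2) (Measure.count : Measure ℕ) := by
    rw [integrable_count_iff]
    simpa using hs
  have hm : MemLp x (ENNReal.ofReal 2) (Measure.count : Measure ℕ) := by
    have := (memLp_two_iff_integrable_sq_norm (AEStronglyMeasurable.of_discrete (f := x))).2 hi
    simpa using this
  -- Counting measure has no nonempty null sets, so almost everywhere means everywhere.
  have hF : ∀ n, hm.toLp x n = x n := Measure.ae_count_iff.1 hm.coeFn_toLp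
  refine ⟨hm.toLp x, hF, ?_⟩
  have h := Lp.norm_rpow_eq_integral two_pos (hm.toLp x)
  simp only [hF, Real.rpow_two] at h
  rw [h, integral_countable hi]
  simpa using hs.tsum_le_tsum hx hc

/-- Scaling `x` by `t = √(‖y‖ / ‖x‖)` and `y` by `t⁻¹` leaves every coefficient unchanged and
equalises the norms. Summability of `‖x‖ * ‖y‖` then becomes square-summability of each factor. -/
theorem norm_balanced {E : Type*} [NormedAddCommGroup E] [NormedSpace ℂ E] (x : E)
    (y : StrongDual ℂ E) : ∃ (x' : E) (y' : StrongDual ℂ E), ‖x'‖ ^ 2 ≤ ‖x‖ * ‖y‖ ∧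
      ‖y'‖ ^ 2 ≤ ‖x‖ * ‖y‖ ∧ ∀ T : E →ₗᵢ[ℂ] E, y' (T x') = y (T x) := by
  rcases eq_or_ne x 0 with rfl | hx
  · exact ⟨0, 0, by simp, by simp, fun T => by simp⟩
  rcases eq_or_ne y 0 with rfl | hy
  · exact ⟨0, 0, by simp, by simp, fun T => by simp⟩
  have hx' : 0 < ‖x‖ := norm_pos_iff.2 hx
  have hy' : 0 < ‖y‖ := norm_pos_iff.2 hy
  set t := √(‖y‖ / ‖x‖) with ht
  have ht0 : 0 < t := Real.sqrt_pos.2 (by positivity)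
  have ht2 : t ^ 2 = ‖y‖ / ‖x‖ := Real.sq_sqrt (by positivity)
  refine ⟨(t : ℂ) • x, (t : ℂ)⁻¹ • y, ?_, ?_, fun T => ?_⟩
  · rw [norm_smul, Complex.norm_real, mul_pow, Real.norm_eq_abs, sq_abs, ht2]
    exact le_of_eq (by field_simp)
  · rw [norm_smul, norm_inv, Complex.norm_real, mul_pow, inv_pow, Real.norm_eq_abs, sq_abs, ht2]
    exact le_of_eq (by field_simp)
  · have : (t : ℂ) ≠ 0 := by exact_mod_cast ht0.ne'
    rw [map_smul, smul_apply, map_smul, smul_smul, inv_mul_cancel₀ this,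
      one_smul]

/-- An absolutely convergent sum of coefficients of a representation on `E` is a single
coefficient of its amplification to the square-summable sequences in `E`. -/
theorem exists_sqSummable_coefficient {E : Type*} [NormedAddCommGroup E] [NormedSpace ℂ E]
    (x : ℕ → E) (y : ℕ → StrongDual ℂ E) (c : ℕ → ℝ) (hc : Summable c)
    (hxy : ∀ n, ‖x n‖ * ‖y n‖ ≤ c n) :
    ∃ (η : SqSummableSeq E) (ξ : StrongDual ℂ (SqSummableSeq E)),
      ‖η‖ ^ 2 ≤ ∑' n, c n ∧ ‖ξ‖ ^ 2 ≤ ∑' n, c n ∧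
      ∀ T : E →ₗᵢ[ℂ] E, HasSum (fun n => y n (T (x n)))
        (ξ (Lp.mapIsometry (ENNReal.ofReal 2) Measure.count T η)) := by
  choose x' y' hx' hy' hT using fun n => norm_balanced (x n) (y n)
  obtain ⟨η, hη, hη'⟩ := exists_sqSummableSeq x' c hc fun n => (hx' n).trans (hxy n)
  obtain ⟨Φ, hΦ, hΦ'⟩ := exists_sqSummableSeq y' c hc fun n => (hy' n).trans (hxy n)
  refine ⟨η, Lp.dualPairing _ Φ, hη', ?_, fun T => ?_⟩
  · refine le_trans ?_ hΦ'
    have := Lp.norm_dualPairing_le (b := ENNReal.ofReal 2) Φ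
    gcongr
  · have hTη := Measure.ae_count_iff.1 (Lp.coeFn_mapIsometry (b := ENNReal.ofReal 2) T η)
    have hsum : Summable fun n => ‖y n (T (x n))‖ := by
      refine hc.of_nonneg_of_le (fun n => norm_nonneg _) fun n => le_trans ?_ (hxy n)
      rw [mul_comm, ← T.norm_map]
      exact (y n).le_opNorm _
    rw [Lp.dualPairing_apply]
    simp only [hTη, hΦ, hη, hT]
    rw [integral_countable (by rw [integrable_count_iff]; exact hsum)]
    simpa using hsum.of_norm.hasSum

end VectorValuedLp

/-! ### Translations -/

section Translation

variable {G : Type*} [Group G] [TopologicalSpace G] [IsTopologicalGroup G]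
  [LocallyCompactSpace G] [MeasurableSpace G] [BorelSpace G]

/-- Left translation `(λ(x)F)(s) = F(x⁻¹s)` on `L^b(G; E)`. -/
noncomputable def leftTranslation (E : Type*) [NormedAddCommGroup E] [NormedSpace ℂ E]
    (b : ℝ≥0∞) [Fact (1 ≤ b)] (x : G) :
    Lp E b (Measure.haar : Measure G) →ₗᵢ[ℂ] Lp E b (Measure.haar : Measure G) :=
  Lp.compMeasurePreservingₗᵢ ℂ (fun s => x⁻¹ * s) (measurePreserving_mul_left Measure.haar x⁻¹)

variable {E : Type*} [NormedAddCommGroup E] [NormedSpace ℂ E] {b : ℝ≥0∞} [Fact (1 ≤ b)]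

theorem coeFn_leftTranslation (x : G) (F : Lp E b (Measure.haar : Measure G)) :
    ∀ᵐ s ∂(Measure.haar : Measure G), leftTranslation E b x F s = F (x⁻¹ * s) :=
  Lp.coeFn_compMeasurePreserving F (measurePreserving_mul_left Measure.haar x⁻¹)

theorem leftTranslation_one (F : Lp E b (Measure.haar : Measure G)) :
    leftTranslation E b 1 F = F := by
  refine Lp.ext ?_
  filter_upwards [coeFn_leftTranslation 1 F] with s hs
  rw [hs, inv_one, one_mul]

theorem leftTranslation_mul (x y : G) (F : Lp E b (Measure.haar : Measure G)) :
    leftTranslation E b (x * y) F = leftTranslation E b x (leftTranslation E b y F) := by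
  refine Lp.ext ?_
  filter_upwards [coeFn_leftTranslation (x * y) F,
    coeFn_leftTranslation x (leftTranslation E b y F),
    (measurePreserving_mul_left (Measure.haar : Measure G) x⁻¹).quasiMeasurePreserving.ae
      (coeFn_leftTranslation y F)] with s h1 h2 h3
  rw [h1, h2, h3, mul_inv_rev, mul_assoc]

theorem integral_mul_leftTranslation {a : ℝ≥0∞} (φ : Lp ℂ a (Measure.haar : Measure G))
    (v : Lp ℂ b (Measure.haar : Measure G)) (x : G) :
    ∫ s, φ s * leftTranslation ℂ b x v s ∂(Measure.haar : Measure G) =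
      haarConv φ (invCheck v) x := by
  refine integral_congr_ae ?_
  filter_upwards [coeFn_leftTranslation x v] with s hs
  rw [hs, invCheck, mul_inv_rev, inv_inv]

variable {H : Type*} [Group H] [TopologicalSpace H] [IsTopologicalGroup H]
  [LocallyCompactSpace H] [MeasurableSpace H] [BorelSpace H]

/-- Translation in both variables on `L^b(G; L^c(H))`. -/
noncomputable def biTranslation (b c : ℝ≥0∞) [Fact (1 ≤ b)] [Fact (1 ≤ c)] (z : G × H) :
    Lp (Lp ℂ c (Measure.haar : Measure H)) b (Measure.haar : Measure G) →ₗᵢ[ℂ]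
      Lp (Lp ℂ c (Measure.haar : Measure H)) b (Measure.haar : Measure G) :=
  (leftTranslation _ b z.1).comp (Lp.mapIsometry b Measure.haar (leftTranslation ℂ c z.2))

variable {c : ℝ≥0∞} [Fact (1 ≤ c)]

theorem biTranslation_apply (z : G × H)
    (F : Lp (Lp ℂ c (Measure.haar : Measure H)) b (Measure.haar : Measure G)) :
    biTranslation b c z F =
      leftTranslation _ b z.1 (Lp.mapIsometry b Measure.haar (leftTranslation ℂ c z.2) F) := rfl

theorem biTranslation_one
    (F : Lp (Lp ℂ c (Measure.haar : Measure H)) b (Measure.haar : Measure G)) :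
    biTranslation b c (1 : G × H) F = F :=
  (leftTranslation_one _).trans
    (Lp.mapIsometry_eq_self (T := leftTranslation ℂ c (1 : H)) leftTranslation_one F)

theorem biTranslation_mul (z z' : G × H)
    (F : Lp (Lp ℂ c (Measure.haar : Measure H)) b (Measure.haar : Measure G)) :
    biTranslation b c (z * z') F = biTranslation b c z (biTranslation b c z' F) := by
  simp only [biTranslation_apply, Prod.fst_mul, Prod.snd_mul]
  rw [leftTranslation_mul, Lp.mapIsometry_comp (T := leftTranslation ℂ c z.2) (S := leftTranslation ℂ c z'.2)
    (R := leftTranslation ℂ c (z.2 * z'.2)) (leftTranslation_mul z.2 z'.2)]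
  congr 1
  -- Translation in `G` commutes with the pointwise action of translation in `H`.
  exact (Lp.mapIsometry_compMeasurePreserving _ _ _).symm

theorem dualPairing_biTranslation {a d : ℝ≥0∞} [Fact (1 ≤ a)] [Fact (1 ≤ d)]
    [ENNReal.HolderConjugate a b] [ENNReal.HolderConjugate d c]
    (φ : Lp ℂ a (Measure.haar : Measure G)) (v : Lp ℂ b (Measure.haar : Measure G))
    (ψ : Lp ℂ d (Measure.haar : Measure H)) (w : Lp ℂ c (Measure.haar : Measure H))
    (x : G) (y : H) :
    Lp.dualPairing b (Lp.tensor φ (Lp.scalarDualPairing c ψ))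
      (biTranslation b c (x, y) (Lp.tensor v w)) =
      haarConv φ (invCheck v) x * haarConv ψ (invCheck w) y := by
  have h : biTranslation b c (x, y) (Lp.tensor v w) =
      Lp.tensor (leftTranslation ℂ b x v) (leftTranslation ℂ c y w) := by
    rw [biTranslation_apply, Lp.mapIsometry_tensor]
    exact Lp.compMeasurePreserving_tensor _ v _
  rw [h, Lp.dualPairing_tensor, Lp.scalarDualPairing_apply, integral_mul_leftTranslation,
    integral_mul_leftTranslation]

end Translation

/-! ### Expansions of elements of `A_p(G) ⊗̂ A_q(H)` -/

section Expansion

variable {G : Type u} [Group G] [TopologicalSpace G] [IsTopologicalGroup G]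
  [LocallyCompactSpace G] [MeasurableSpace G] [BorelSpace G]
  {H : Type v} [Group H] [TopologicalSpace H] [IsTopologicalGroup H]
  [LocallyCompactSpace H] [MeasurableSpace H] [BorelSpace H]

/-- `g(x, y) = ∑ (φₙ * v̌ₙ)(x) (ψₙ * w̌ₙ)(y)` with `∑ ‖φₙ‖ ‖vₙ‖ ‖ψₙ‖ ‖wₙ‖ ≤ r`. -/
def HasProductExpansion (p q : ℝ) (g : G × H → ℂ) (r : ℝ) : Prop :=
  ∃ (φ : ℕ → LpHaar p G) (v : ℕ → LpHaar p.conjExponent G)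
    (ψ : ℕ → LpHaar q H) (w : ℕ → LpHaar q.conjExponent H),
    (∃ s ≤ r, HasSum (fun n => ‖φ n‖ * ‖v n‖ * (‖ψ n‖ * ‖w n‖)) s) ∧
    ∀ x y, HasSum (fun n => haarConv (φ n) (invCheck (v n)) x *
      haarConv (ψ n) (invCheck (w n)) y) (g (x, y))

variable {p q : ℝ}

theorem HasProductExpansion.mono {g : G × H → ℂ} {r s : ℝ}
    (h : HasProductExpansion p q g r) (hrs : r ≤ s) : HasProductExpansion p q g s := by
  obtain ⟨φ, v, ψ, w, ⟨t, ht, h1⟩, h2⟩ := h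
  exact ⟨φ, v, ψ, w, ⟨t, ht.trans hrs, h1⟩, h2⟩

theorem HasProductExpansion.zero [Fact (1 < p)] [Fact (1 < q)] :
    HasProductExpansion p q (0 : G × H → ℂ) 0 := by
  have h : ∀ x : G, haarConv ((0 : LpHaar p G) : G → ℂ)
      (invCheck ((0 : LpHaar p.conjExponent G) : G → ℂ)) x = 0 := fun x => by
    simpa using norm_haarConv_le p (0 : LpHaar p G) 0 x
  refine ⟨fun _ => 0, fun _ => 0, fun _ => 0, fun _ => 0, ⟨0, le_rfl, ?_⟩, fun x y => ?_⟩
  · simp [hasSum_zero]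
  · simp only [h, zero_mul, Pi.zero_apply]
    exact hasSum_zero

theorem HasProductExpansion.add {g g' : G × H → ℂ} {r r' : ℝ}
    (h : HasProductExpansion p q g r) (h' : HasProductExpansion p q g' r') :
    HasProductExpansion p q (g + g') (r + r') := by
  obtain ⟨φ, v, ψ, w, ⟨s, hs, h1⟩, h2⟩ := h
  obtain ⟨φ', v', ψ', w', ⟨s', hs', h1'⟩, h2'⟩ := h'
  -- The two expansions are interleaved over even and odd indices. A general `Φ` covers both the
  -- real costs and the complex values.
  have key : ∀ {α : Type} [AddCommMonoid α] [TopologicalSpace α] [ContinuousAdd α]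
      (Φ : LpHaar p G → LpHaar p.conjExponent G → LpHaar q H → LpHaar q.conjExponent H → α)
      (a b : α), HasSum (fun n => Φ (φ n) (v n) (ψ n) (w n)) a →
      HasSum (fun n => Φ (φ' n) (v' n) (ψ' n) (w' n)) b →
      HasSum (fun n => Φ (if Even n then φ (n / 2) else φ' (n / 2))
        (if Even n then v (n / 2) else v' (n / 2)) (if Even n then ψ (n / 2) else ψ' (n / 2))
        (if Even n then w (n / 2) else w' (n / 2))) (a + b) := by
    intro α _ _ _ Φ a b ha hb
    refine HasSum.even_add_odd ?_ ?_
    · simpa using ha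
    · have : ∀ k : ℕ, (2 * k + 1) / 2 = k := fun k => by omega
      simpa [this] using hb
  exact ⟨_, _, _, _, ⟨s + s', add_le_add hs hs',
      key (fun a b c d => ‖a‖ * ‖b‖ * (‖c‖ * ‖d‖)) _ _ h1 h1'⟩,
    fun x y => key (fun a b c d => haarConv a (invCheck b) x * haarConv c (invCheck d) y) _ _
      (h2 x y) (h2' x y)⟩

theorem IsFTHExpansion.hasProductExpansion [Fact (1 < p)] [Fact (1 < q)] {a : G → ℂ} {b : H → ℂ}
    {φ : ℕ → LpHaar p G} {v : ℕ → LpHaar p.conjExponent G}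
    {ψ : ℕ → LpHaar q H} {w : ℕ → LpHaar q.conjExponent H}
    (ha : IsFTHExpansion p a φ v) (hb : IsFTHExpansion q b ψ w) :
    HasProductExpansion p q (fun z : G × H => a z.1 * b z.2)
      ((∑' n, ‖φ n‖ * ‖v n‖) * ∑' n, ‖ψ n‖ * ‖w n‖) := by
  have hs := Summable.mul_of_nonneg ha.1 hb.1
    (fun n => mul_nonneg ENNReal.toReal_nonneg ENNReal.toReal_nonneg)
    (fun n => mul_nonneg ENNReal.toReal_nonneg ENNReal.toReal_nonneg)
  have hr := HasSum.mul ha.1.hasSum hb.1.hasSum hs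
  have hx : ∀ x y, HasSum (fun k : ℕ × ℕ => haarConv (φ k.1) (invCheck (v k.1)) x *
      haarConv (ψ k.2) (invCheck (w k.2)) y) (a x * b y) := fun x y => by
    have hs' : Summable fun k : ℕ × ℕ => haarConv (φ k.1) (invCheck (v k.1)) x *
        haarConv (ψ k.2) (invCheck (w k.2)) y := by
      refine Summable.of_norm_bounded hs fun k => ?_
      rw [norm_mul]
      exact mul_le_mul (norm_haarConv_le p (φ k.1) (v k.1) x)
        (norm_haarConv_le q (ψ k.2) (w k.2) y) (norm_nonneg _)
        (mul_nonneg ENNReal.toReal_nonneg ENNReal.toReal_nonneg)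
    have hxy := HasSum.mul (ha.2 x) (hb.2 y) hs'
    exact hxy
  -- The product of the two series is indexed by pairs; absolute convergence permits relabelling by
  -- `ℕ`.
  have e : ℕ ≃ ℕ × ℕ := Nat.pairEquiv.symm
  have he : ∀ {α : Type} [AddCommMonoid α] [TopologicalSpace α] (Φ : ℕ × ℕ → α) (c : α),
      HasSum Φ c → HasSum (fun n => Φ (e n)) c := fun Φ c h => e.hasSum_iff.2 h
  have hr' := he _ _ hr
  have hx' := fun x y => he _ _ (hx x y)
  exact ⟨fun n => φ (e n).1, fun n => v (e n).1, fun n => ψ (e n).2, fun n => w (e n).2,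
    ⟨_, le_rfl, hr'⟩, hx'⟩

variable [Fact (1 < p)] [Fact (1 < q)]

theorem FTHAlgebra.hasProductExpansion_mul (a : FTHAlgebra G p) (b : FTHAlgebra H q) {δ : ℝ}
    (hδ : 0 < δ) :
    HasProductExpansion p q (fun z : G × H => a z.1 * b z.2) (‖a‖ * ‖b‖ + δ) := by
  have hD : 0 < ‖a‖ + ‖b‖ + 1 := by positivity
  -- Chosen so that `(‖a‖ + ε) * (‖b‖ + ε)` exceeds `‖a‖ * ‖b‖` by `ε * (‖a‖ + ‖b‖ + ε) ≤ δ`.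
  set ε := min 1 (δ / (‖a‖ + ‖b‖ + 1)) with hε
  have hε0 : 0 < ε := lt_min one_pos (by positivity)
  have hε1 : ε ≤ 1 := min_le_left _ _
  have hεδ : ε * (‖a‖ + ‖b‖ + 1) ≤ δ := by
    rw [← le_div_iff₀ hD]
    exact min_le_right _ _
  obtain ⟨_, ⟨φ, v, ha, rfl⟩, ha'⟩ := exists_lt_of_csInf_lt a.2
    (show sInf (fthCosts p a.1) < ‖a‖ + ε from lt_add_of_pos_right _ hε0)
  obtain ⟨_, ⟨ψ, w, hb, rfl⟩, hb'⟩ := exists_lt_of_csInf_lt b.2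
    (show sInf (fthCosts q b.1) < ‖b‖ + ε from lt_add_of_pos_right _ hε0)
  refine (ha.hasProductExpansion hb).mono ?_
  calc _ ≤ (‖a‖ + ε) * (‖b‖ + ε) := by
        refine mul_le_mul ha'.le hb'.le (tsum_nonneg fun n => by positivity) (by positivity)
    _ ≤ ‖a‖ * ‖b‖ + δ := by nlinarith [norm_nonneg a, norm_nonneg b]

theorem hasProductExpansion_sum (n : ℕ) (a : Fin n → FTHAlgebra G p) (b : Fin n → FTHAlgebra H q)
    {δ : ℝ} (hδ : 0 < δ) :
    HasProductExpansion p q (fun z : G × H => ∑ i, a i z.1 * b i z.2)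
      ((∑ i, ‖a i‖ * ‖b i‖) + δ) := by
  induction n generalizing δ with
  | zero =>
    simp only [Finset.univ_eq_empty, Finset.sum_empty, zero_add]
    exact HasProductExpansion.zero.mono hδ.le
  | succ n ih =>
    simp only [Fin.sum_univ_succ]
    refine (((a 0).hasProductExpansion_mul (b 0) (half_pos hδ)).add
      (ih (fun i => a i.succ) (fun i => b i.succ) (half_pos hδ))).mono (le_of_eq ?_)
    ring

theorem gelfandTransform_hasProductExpansion
    (u : AlgProjTensor (FTHAlgebra G p) (FTHAlgebra H q)) {r : ℝ} (hr : ‖u‖ < r) :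
    HasProductExpansion p q
      (gelfandTransform (u : ProjTensor (FTHAlgebra G p) (FTHAlgebra H q))) r := by
  obtain ⟨_, ⟨n, a, b, hu, rfl⟩, hs⟩ := exists_lt_of_csInf_lt (projCosts_nonempty _) hr
  have h : gelfandTransform (u : ProjTensor (FTHAlgebra G p) (FTHAlgebra H q)) =
      fun z : G × H => ∑ i, a i z.1 * b i z.2 := by
    funext z
    refine (ProjTensor.functional_coe _ _ u).trans ?_
    change LinearMap.mul' ℂ ℂ (TensorProduct.map _ _ u) = _
    rw [hu, map_sum, map_sum]
    rfl
  rw [h]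
  -- The strict inequality leaves room for the error `δ`, the difference between `r` and the chosen
  -- cost.
  exact (hasProductExpansion_sum n a b (sub_pos.2 hs)).mono (le_of_eq (by ring))

/-! ### The uniformly convex space carrying all coefficients. -/

/-- The space `ℓ²(L^{p'}(G; L^{q'}(H)))`. -/
abbrev CoefficientSpace (p q : ℝ) (G : Type u) [Group G] [TopologicalSpace G]
    [IsTopologicalGroup G] [LocallyCompactSpace G] [MeasurableSpace G] [BorelSpace G]
    (H : Type v) [Group H] [TopologicalSpace H] [IsTopologicalGroup H]
    [LocallyCompactSpace H] [MeasurableSpace H] [BorelSpace H] [Fact (1 < p)] [Fact (1 < q)] :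
    Type (max u v) :=
  SqSummableSeq (Lp (LpHaar q.conjExponent H) (ENNReal.ofReal p.conjExponent)
    (Measure.haar : Measure G))

/-- Starting from `ℂ`, each layer preserves rotundity for its own exponent: `q'`, then `p'`, then 2.
Passing through uniform convexity changes the exponent between layers. -/
theorem uniformlyRotund_coefficientSpace : UniformlyRotund 2 (CoefficientSpace p q G H) := by
  have hp := Fact.out (p := 1 < p.conjExponent)
  have hq := Fact.out (p := 1 < q.conjExponent)
  have h1 : UniformlyRotund _ (LpHaar q.conjExponent H) :=
    (UniformConvexSpace.uniformlyRotund hq ℂ).lp _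
  have := h1.uniformConvexSpace hq.le
  have h2 : UniformlyRotund _ (Lp (LpHaar q.conjExponent H) (ENNReal.ofReal p.conjExponent)
      (Measure.haar : Measure G)) := (UniformConvexSpace.uniformlyRotund hp _).lp _
  have := h2.uniformConvexSpace hp.le
  exact (UniformConvexSpace.uniformlyRotund one_lt_two _).lp _

/-- The representation of `G × H` by translations on `ℓ²(L^{p'}(G; L^{q'}(H)))`. -/
noncomputable def coefficientRep (p q : ℝ) [Fact (1 < p)] [Fact (1 < q)] (z : G × H) :
    CoefficientSpace p q G H →ₗᵢ[ℂ] CoefficientSpace p q G H :=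
  Lp.mapIsometry _ _ (biTranslation _ _ z)

theorem coefficientRep_one (η : CoefficientSpace p q G H) :
    coefficientRep p q (1 : G × H) η = η :=
  Lp.mapIsometry_eq_self (T := biTranslation _ _ (1 : G × H)) biTranslation_one η

theorem coefficientRep_mul (z z' : G × H) (η : CoefficientSpace p q G H) :
    coefficientRep p q (z * z') η = coefficientRep p q z (coefficientRep p q z' η) :=
  Lp.mapIsometry_comp (T := biTranslation _ _ z) (S := biTranslation _ _ z')
    (R := biTranslation _ _ (z * z')) (biTranslation_mul z z') η

instance holderConjugate_ofReal_conjExponent (p : ℝ) [hp : Fact (1 < p)] :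
    ENNReal.HolderConjugate (ENNReal.ofReal p) (ENNReal.ofReal p.conjExponent) :=
  (Real.HolderConjugate.conjExponent hp.out).ennrealOfReal

theorem HasProductExpansion.exists_coefficient {g : G × H → ℂ} {r : ℝ}
    (h : HasProductExpansion p q g r) :
    ∃ (η : CoefficientSpace p q G H) (ξ : StrongDual ℂ (CoefficientSpace p q G H)),
      ‖η‖ ≤ √r ∧ ‖ξ‖ ≤ √r ∧ ∀ z, ξ (coefficientRep p q z η) = g z := by
  obtain ⟨φ, v, ψ, w, ⟨s, hs, h1⟩, h2⟩ := h
  obtain ⟨η, ξ, hη, hξ, hT⟩ := exists_sqSummable_coefficient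
    (fun n => Lp.tensor (v n) (w n))
    (fun n => Lp.dualPairing (ENNReal.ofReal p.conjExponent)
      (Lp.tensor (φ n) (Lp.scalarDualPairing (ENNReal.ofReal q.conjExponent) (ψ n))))
    (fun n => ‖φ n‖ * ‖v n‖ * (‖ψ n‖ * ‖w n‖)) h1.summable (fun n => by
      calc _ ≤ (‖v n‖ * ‖w n‖) * (‖φ n‖ * ‖ψ n‖) := by
            gcongr
            · exact Lp.norm_tensor_le _ _
            · refine (Lp.norm_dualPairing_le _).trans ((Lp.norm_tensor_le _ _).trans ?_)
              gcongr
              exact Lp.norm_scalarDualPairing_le _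
        _ = _ := by ring)
  rw [h1.tsum_eq] at hη hξ
  refine ⟨η, ξ, Real.le_sqrt_of_sq_le (hη.trans hs), Real.le_sqrt_of_sq_le (hξ.trans hs),
    fun z => (hT (biTranslation _ _ z)).unique ?_⟩
  simp only [dualPairing_biTranslation _ _ _ _ z.1 z.2]
  exact h2 z.1 z.2

/-- A nearby algebraic tensor of norm below `C + ε` has an exact coefficient. The error may depend
on `z`, since only pointwise limits are taken. -/
theorem exists_approximate_coefficient (u : ProjTensor (FTHAlgebra G p) (FTHAlgebra H q))
    {C ε : ℝ} (hu : ‖u‖ ≤ C) (hε : 0 < ε) :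
    ∃ (η : CoefficientSpace p q G H) (ξ : StrongDual ℂ (CoefficientSpace p q G H)),
      ‖η‖ ≤ √(C + ε) ∧ ‖ξ‖ ≤ √(C + ε) ∧
      ∀ z : G × H, ‖gelfandTransform u z - ξ (coefficientRep p q z η)‖ ≤
        ‖ProjTensor.functional (FTHAlgebra.eval (p := p) z.1) (FTHAlgebra.eval (p := q) z.2)‖ *
          ε := by
  obtain ⟨_, hu', u', rfl⟩ := Metric.dense_iff.1
    (UniformSpace.Completion.denseRange_coe
      (α := AlgProjTensor (FTHAlgebra G p) (FTHAlgebra H q))) u ε hε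
  rw [Metric.mem_ball, dist_comm, dist_eq_norm] at hu'
  have h1 : ‖u'‖ < C + ε := by
    have := norm_le_norm_add_norm_sub' (u' : ProjTensor (FTHAlgebra G p) (FTHAlgebra H q)) u
    rw [UniformSpace.Completion.norm_coe, norm_sub_rev] at this
    linarith
  obtain ⟨η, ξ, hη, hξ, h⟩ := (gelfandTransform_hasProductExpansion u' h1).exists_coefficient
  refine ⟨η, ξ, hη, hξ, fun z => ?_⟩
  rw [h, gelfandTransform, gelfandTransform, ← map_sub]
  exact ContinuousLinearMap.le_opNorm_of_le _ hu'.le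

end Expansion

/-! ### Passage to the limit. -/

/-- `IsometricRep (G × H) ⊥ E`: the group `G × H` carries the discrete topology `⊥`, that is, it is
`G_d × H_d`. -/
theorem proposition2p6
    {G : Type u} [Group G] [TopologicalSpace G] [IsTopologicalGroup G]
    [LocallyCompactSpace G] [MeasurableSpace G] [BorelSpace G]
    {H : Type v} [Group H] [TopologicalSpace H] [IsTopologicalGroup H]
    [LocallyCompactSpace H] [MeasurableSpace H] [BorelSpace H]
    (p q : ℝ) [Fact (1 < p)] [Fact (1 < q)]
    {A : Type w} [Preorder A] [IsDirectedOrder A] [Nonempty A]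
    (F : A → ProjTensor (FTHAlgebra G p) (FTHAlgebra H q))
    (hbdd : ∃ C : ℝ, ∀ α, ‖F α‖ ≤ C)
    (f : G × H → ℂ)
    (hlim : ∀ z, Tendsto (fun α => gelfandTransform (F α) z) atTop (𝓝 (f z))) :
    ∃ (E : Type (max u v w)) (_ : NormedAddCommGroup E) (_ : NormedSpace ℂ E) (_ : CompleteSpace E)
      (_ : UniformConvexSpace E) (π : IsometricRep (G × H) ⊥ E),
      ∀ C : ℝ, 0 ≤ C → (∀ α, ‖F α‖ ≤ C) →
        ∃ (η : E) (ξ : StrongDual ℂ E), ‖η‖ * ‖ξ‖ ≤ C ∧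
          ∀ (x : G) (y : H), f (x, y) = ξ (π.toHom (x, y) η) := by
  obtain ⟨C₁, hC₁⟩ := hbdd
  -- Working with the exact supremum makes the space, the vector and the functional independent of
  -- `C`.
  set C₀ := ⨆ α, ‖F α‖ with hC₀
  have hF : ∀ α, ‖F α‖ ≤ C₀ := le_ciSup ⟨C₁, by rintro _ ⟨α, rfl⟩; exact hC₁ α⟩
  have hC₀0 : 0 ≤ C₀ := Real.iSup_nonneg fun α => norm_nonneg _
  choose η ξ hη hξ happ using fun i : A × ℕ =>
    exists_approximate_coefficient (F i.1) (hF i.1) (Nat.one_div_pos_of_nat (α := ℝ) (n := i.2))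
  -- The second index carries the approximation error `1 / (n + 1)`; along `U` the net index and `n`
  -- tend to infinity together.
  let U : Ultrafilter (A × ℕ) := Ultrafilter.of (atTop ×ˢ atTop)
  have hU : (U : Filter (A × ℕ)) ≤ atTop ×ˢ atTop := Ultrafilter.of_le _
  have hfst : Tendsto Prod.fst (U : Filter (A × ℕ)) atTop := tendsto_fst.mono_left hU
  have hε : Tendsto (fun i : A × ℕ => 1 / ((i.2 : ℝ) + 1)) U (𝓝 0) :=
    tendsto_one_div_add_atTop_nhds_zero_nat.comp (tendsto_snd.mono_left hU)
  have hc : Tendsto (fun i : A × ℕ => √(C₀ + 1 / ((i.2 : ℝ) + 1))) U (𝓝 √C₀) := by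
    have := (hε.const_add C₀).sqrt
    rwa [add_zero] at this
  have hB : ∀ i : A × ℕ, √(C₀ + 1 / ((i.2 : ℝ) + 1)) ≤ √(C₀ + 1) := fun i => by
    refine Real.sqrt_le_sqrt (add_le_add_right ?_ C₀)
    rw [div_le_one (by positivity)]
    linarith [Nat.cast_nonneg (α := ℝ) i.2]
  have hf : ∀ z, Tendsto (fun i => ξ i (coefficientRep p q z (η i))) U (𝓝 (f z)) := fun z => by
    have h1 : Tendsto (fun i : A × ℕ => gelfandTransform (F i.1) z -
        ξ i (coefficientRep p q z (η i))) U (𝓝 0) := by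
      refine squeeze_zero_norm (fun i => happ i z) ?_
      simpa using hε.const_mul _
    simpa using ((hlim z).comp hfst).sub h1
  obtain ⟨E, i1, i2, i3, i4, π, η', ξ', hη', hξ', hπ⟩ :=
    exists_ultrapower_coefficient (X := CoefficientSpace p q G H) U
      uniformlyRotund_coefficientSpace (coefficientRep p q) coefficientRep_one coefficientRep_mul
      η ξ (fun i => √(C₀ + 1 / ((i.2 : ℝ) + 1))) hη hξ √(C₀ + 1) hB √C₀ hc f hf
  refine ⟨E, i1, i2, i3, i4, ⟨π, fun _ => continuous_bot⟩, fun C _ hC => ⟨η', ξ', ?_,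
    fun x y => hπ (x, y)⟩⟩
  calc ‖η'‖ * ‖ξ'‖ ≤ √C₀ * √C₀ :=
        mul_le_mul hη' hξ' (norm_nonneg _) (Real.sqrt_nonneg _)
    _ = C₀ := Real.mul_self_sqrt hC₀0
    _ ≤ C := ciSup_le hC
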